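/- Consider $L$ access points (APs) with $M$ antennas each and $K$ single-antenna users. The channel from AP $l$ to user $k$ is $\mathbf h_{l,k}\sim\mathcal{CN}(\mathbf 0,\beta_{l,k}\mathbf I_M)$ with $\beta_{l,k}\ge 0$ (independent Rayleigh fading). Let $\boldsymbol\phi_1,\dots,\boldsymbol\phi_{\tau_p}\in\mathbb C^{\tau_p}$ be pilots with $\boldsymbol\phi_i^{\mathrm H}\boldsymbol\phi_j=\tau_p$ if $i=j$ and $0$ otherwise, and put $\mathbf\Phi=[\boldsymbol\phi_1,\dots,\boldsymbol\phi_{\tau_p}]$. User $k$ sends pilot $i_k\in\{1,\dots,\tau_p\}$ with power $p_k\ge 0$; pilots may be reused, and $\mathcal P_k=\{t: i_t=i_k\}\ni k$. AP $l$ receives $$\mathbf Y_l=\sum_{k=1}^K \mathbf h_{l,k}\sqrt{p_k}\,\boldsymbol\phi_{i_k}^{\mathrm H}+\mathbf N_l\in\mathbb C^{M\times\tau_p},$$ where $\mathbf N_l$ has i.i.d. $\mathcal{CN}(0,1)$ entries, and all the channels $\mathbf h_{l,k}$ and noise matrices $\mathbf N_l$ are mutually independent. Let $\hat{\mathbf h}_{l,k}=c_{l,k}\mathbf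 Y_l\boldsymbol\phi_{i_k}$ with $c_{l,k}=\sqrt{p_k}\beta_{l,k}/(\tau_p\sum_{t\in\mathcal P_k}p_t\beta_{l,t}+1)$ be the MMSE channel estimates, let $$\gamma_{l,k}=\mathbb E\{|[\hat{\mathbf h}_{l,k}]_m|^2\}=\frac{p_k\tau_p\beta_{l,k}^2}{\tau_p\sum_{t\in\mathcal P_k}p_t\beta_{l,t}+1}\qquad(m=1,\dots,M),$$ and let $\bar{\mathbf H}_l=\mathbf Y_l\mathbf\Phi$. With downlink powers $\rho_{l,k}\ge 0$, the local full-pilot zero-forcing (FZF) precoders are $$\mathbf w_{l,i}=\frac{\bar{\mathbf H}_l(\bar{\mathbf H}_l^{\mathrm H}\bar{\mathbf H}_l)^{-1}\mathbf e_i}{\sqrt{\mathbb E\{\|\bar{\mathbf H}_l(\bar{\mathbf H}_l^{\mathrm H}\bar{\mathbf H}_l)^{-1}\mathbf e_i\|^2\}}},\qquad i=1,\dots,\tau_p,$$ and the SINR of user $k$ in the hardening bound is $$\mathsf{SINR}_k=\frac{|\mathrm{CP}_k|^2}{\mathbb E\{|\mathrm{PU}_k|^2\}+\sum_{t\ne k}\mathbb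 E\{|\mathrm{UI}_{kt}|^2\}+1},$$ where $\mathrm{CP}_k=\sum_l\sqrt{\rho_{l,k}}\,\mathbb E\{\mathbf h_{l,k}^{\mathrm H}\mathbf w_{l,i_k}\}$, $\mathrm{PU}_k=\sum_l\bigl(\sqrt{\rho_{l,k}}\,\mathbf h_{l,k}^{\mathrm H}\mathbf w_{l,i_k}-\sqrt{\rho_{l,k}}\,\mathbb E\{\mathbf h_{l,k}^{\mathrm H}\mathbf w_{l,i_k}\}\bigr)$ and $\mathrm{UI}_{kt}=\sum_l\sqrt{\rho_{l,t}}\,\mathbf h_{l,k}^{\mathrm H}\mathbf w_{l,i_t}$. If $M>\tau_p$, then the matrices $\bar{\mathbf H}_l^{\mathrm H}\bar{\mathbf H}_l$ are almost surely invertible, the normalizations of the precoders are finite and positive, all expectations above are finite, and for every user $k$ $$\mathsf{SINR}_k=\frac{(M-\tau_p)\Bigl(\sum_{l=1}^L\sqrt{\rho_{l,k}\gamma_{l,k}}\Bigr)^2}{(M-\tau_p)\sum_{t\in\mathcal P_k\setminus\{k\}}\Bigl(\sum_{l=1}^L\sqrt{\rho_{l,t}\gamma_{l,k}}\Bigr)^2+\sum_{l=1}^L\sum_{t=1}^K\rho_{l,t}(\beta_{l,k}-\gamma_{l,k})+1}.$$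 Consequently the hardening-bound spectral efficiency $\mathsf{SE}_k=\xi(1-\tau_p/\tau_c)\log_2(1+\mathsf{SINR}_k)$, for a coherence interval of $\tau_c>\tau_p$ samples and a downlink fraction $0<\xi<1$, is given in closed form by inserting this expression. -/

import Mathlib

open MeasureTheory ProbabilityTheory
open scoped Matrix

noncomputable section

/-- The circularly symmetric complex Gaussian law `CN(0, v)`, for a variance `v ≥ 0`: the real and
imaginary parts are independent real Gaussians with mean zero and variance `v / 2`. -/
def complexGaussian (v : ℝ) : Measure ℂ :=
  ((gaussianReal 0 (v / 2).toNNReal).prod (gaussianReal 0 (v / 2).toNNReal)).map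
    (fun x : ℝ × ℝ => (x.1 : ℂ) + (x.2 : ℂ) * Complex.I)

/-- The squared Euclidean norm of a complex vector. -/
def vecNormSq {M : ℕ} (v : Fin M → ℂ) : ℝ := ∑ m, ‖v m‖ ^ 2

/-- The deterministic parameters of a cell-free network with `L` access points, `K` single-antenna
users and a book of `τ` pilots of length `τ`. -/
structure CellFreeSystem (L K τ : ℕ) where
  /-- large-scale fading coefficients -/
  β : Fin L → Fin K → ℝ
  β_nonneg : ∀ l k, 0 ≤ β l k
  /-- normalized uplink pilot powers -/
  p : Fin K → ℝ
  p_nonneg : ∀ k, 0 ≤ p k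
  /-- normalized downlink powers -/
  ρ : Fin L → Fin K → ℝ
  ρ_nonneg : ∀ l k, 0 ≤ ρ l k
  /-- index of the pilot assigned to each user; several users may share a pilot -/
  pilot : Fin K → Fin τ
  /-- pilot-book matrix, whose columns are the pilot sequences -/
  Φ : Matrix (Fin τ) (Fin τ) ℂ
  /-- the pilots are mutually orthogonal, with squared norm `τ` -/
  Φ_orthogonal : Φᴴ * Φ = (τ : ℂ) • (1 : Matrix (Fin τ) (Fin τ) ℂ)

namespace CellFreeSystem

variable {L K τ M : ℕ} {Ω : Type*} [MeasurableSpace Ω]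

/-- The users that are assigned the same pilot as user `k`, user `k` included. -/
def copilot (S : CellFreeSystem L K τ) (k : Fin K) : Finset (Fin K) :=
  Finset.univ.filter fun t => S.pilot t = S.pilot k

/-- The sequence of pilot number `i`. -/
def pilotSeq (S : CellFreeSystem L K τ) (i : Fin τ) : Fin τ → ℂ := fun s => S.Φ s i

/-- Independent Rayleigh fading with white receiver noise: the antenna entries of the channel from
access point `l` to user `k` are `CN(0, β l k)`, the entries of the pilot noise matrices are
`CN(0, 1)`, and all of these scalar random variables are mutually independent. -/
structure IsRayleigh (S : CellFreeSystem L K τ) (P : Measure Ω)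
    (h : Fin L → Fin K → Ω → (Fin M → ℂ))
    (N : Fin L → Ω → Matrix (Fin M) (Fin τ) ℂ) : Prop where
  law_channel : ∀ l k m, HasLaw (fun ω => h l k ω m) (complexGaussian (S.β l k)) P
  law_noise : ∀ l m s, HasLaw (fun ω => N l ω m s) (complexGaussian 1) P
  indep : iIndepFun
    (Sum.elim
      (fun (j : Fin L × Fin K × Fin M) (ω : Ω) => h j.1 j.2.1 ω j.2.2)
      (fun (j : Fin L × Fin M × Fin τ) (ω : Ω) => N j.1 ω j.2.1 j.2.2)) P

/-- The received pilot signal `Y_l = ∑ₖ h_{l,k} √p_k φ_{i_k}ᴴ + N_l`. -/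
def received (S : CellFreeSystem L K τ) (h : Fin L → Fin K → Ω → (Fin M → ℂ))
    (N : Fin L → Ω → Matrix (Fin M) (Fin τ) ℂ) (l : Fin L) (ω : Ω) :
    Matrix (Fin M) (Fin τ) ℂ :=
  ∑ k, ((Real.sqrt (S.p k) : ℝ) : ℂ) •
      Matrix.vecMulVec (h l k ω) (star (S.pilotSeq (S.pilot k))) + N l ω

/-- The coefficient `c_{l,k}` of the MMSE channel estimate. -/
def c (S : CellFreeSystem L K τ) (l : Fin L) (k : Fin K) : ℝ :=
  Real.sqrt (S.p k) * S.β l k / ((τ : ℝ) * ∑ t ∈ S.copilot k, S.p t * S.β l t + 1)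

/-- The MMSE channel estimate `c_{l,k} Y_l φ_{i_k}`. -/
def estimate (S : CellFreeSystem L K τ) (h : Fin L → Fin K → Ω → (Fin M → ℂ))
    (N : Fin L → Ω → Matrix (Fin M) (Fin τ) ℂ) (l : Fin L) (k : Fin K) (ω : Ω) : Fin M → ℂ :=
  (S.c l k : ℂ) • (S.received h N l ω *ᵥ S.pilotSeq (S.pilot k))

/-- `γ_{l,k}`, the mean square of each entry of the channel estimate, in closed form. -/
def γ (S : CellFreeSystem L K τ) (l : Fin L) (k : Fin K) : ℝ :=
  S.p k * τ * S.β l k ^ 2 / ((τ : ℝ) * ∑ t ∈ S.copilot k, S.p t * S.β l t + 1)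

/-- The full-rank matrix of channel estimates `Y_l Φ`. -/
def Hbar (S : CellFreeSystem L K τ) (h : Fin L → Fin K → Ω → (Fin M → ℂ))
    (N : Fin L → Ω → Matrix (Fin M) (Fin τ) ℂ) (l : Fin L) (ω : Ω) :
    Matrix (Fin M) (Fin τ) ℂ :=
  S.received h N l ω * S.Φ

/-- The unnormalized zero-forcing direction `H̄ (H̄ᴴ H̄)⁻¹ e_i` of access point `l`. -/
def zfDirection (S : CellFreeSystem L K τ) (h : Fin L → Fin K → Ω → (Fin M → ℂ))
    (N : Fin L → Ω → Matrix (Fin M) (Fin τ) ℂ) (l : Fin L) (i : Fin τ) (ω : Ω) : Fin M → ℂ :=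
  (S.Hbar h N l ω * ((S.Hbar h N l ω)ᴴ * S.Hbar h N l ω)⁻¹) *ᵥ Pi.single i 1

/-- The local full-pilot zero-forcing precoder for pilot `i`, with normalization in mean square. -/
def fzf (S : CellFreeSystem L K τ) (P : Measure Ω) (h : Fin L → Fin K → Ω → (Fin M → ℂ))
    (N : Fin L → Ω → Matrix (Fin M) (Fin τ) ℂ) (l : Fin L) (i : Fin τ) (ω : Ω) : Fin M → ℂ :=
  ((Real.sqrt (∫ ω', vecNormSq (S.zfDirection h N l i ω') ∂P) : ℝ) : ℂ)⁻¹ •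
    S.zfDirection h N l i ω

/-- The effective scalar channel `h_{l,k}ᴴ w_{l,i_t}` for the precoders `w`. -/
def gain (S : CellFreeSystem L K τ) (h : Fin L → Fin K → Ω → (Fin M → ℂ))
    (w : Fin L → Fin τ → Ω → (Fin M → ℂ)) (l : Fin L) (k t : Fin K) (ω : Ω) : ℂ :=
  star (h l k ω) ⬝ᵥ w l (S.pilot t) ω

/-- Coherent precoding gain. -/
def CP (S : CellFreeSystem L K τ) (P : Measure Ω) (h : Fin L → Fin K → Ω → (Fin M → ℂ))
    (w : Fin L → Fin τ → Ω → (Fin M → ℂ)) (k : Fin K) : ℂ :=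
  ∑ l, ((Real.sqrt (S.ρ l k) : ℝ) : ℂ) * ∫ ω, S.gain h w l k k ω ∂P

/-- Precoding gain uncertainty. -/
def PU (S : CellFreeSystem L K τ) (P : Measure Ω) (h : Fin L → Fin K → Ω → (Fin M → ℂ))
    (w : Fin L → Fin τ → Ω → (Fin M → ℂ)) (k : Fin K) (ω : Ω) : ℂ :=
  ∑ l, (((Real.sqrt (S.ρ l k) : ℝ) : ℂ) * S.gain h w l k k ω -
    ((Real.sqrt (S.ρ l k) : ℝ) : ℂ) * ∫ ω', S.gain h w l k k ω' ∂P)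

/-- Interference at user `k` from the signal intended for user `t`. -/
def UI (S : CellFreeSystem L K τ) (h : Fin L → Fin K → Ω → (Fin M → ℂ))
    (w : Fin L → Fin τ → Ω → (Fin M → ℂ)) (k t : Fin K) (ω : Ω) : ℂ :=
  ∑ l, ((Real.sqrt (S.ρ l t) : ℝ) : ℂ) * S.gain h w l k t ω

/-- The effective SINR of user `k` in the hardening bound, for arbitrary precoders `w`. -/
def hardeningSINR (S : CellFreeSystem L K τ) (P : Measure Ω)
    (h : Fin L → Fin K → Ω → (Fin M → ℂ)) (w : Fin L → Fin τ → Ω → (Fin M → ℂ))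
    (k : Fin K) : ℝ :=
  ‖S.CP P h w k‖ ^ 2 /
    ((∫ ω, ‖S.PU P h w k ω‖ ^ 2 ∂P) +
      ∑ t ∈ Finset.univ.erase k, (∫ ω, ‖S.UI h w k t ω‖ ^ 2 ∂P) + 1)

/-- The hardening-bound spectral efficiency (bit/s/Hz) of user `k` for arbitrary precoders `w`, with
coherence interval of `τc` samples and fraction `ξ` of the data samples used for the downlink. -/
def hardeningSE (S : CellFreeSystem L K τ) (P : Measure Ω)
    (h : Fin L → Fin K → Ω → (Fin M → ℂ)) (w : Fin L → Fin τ → Ω → (Fin M → ℂ))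
    (ξ : ℝ) (τc : ℕ) (k : Fin K) : ℝ :=
  ξ * (1 - (τ : ℝ) / (τc : ℝ)) * Real.logb 2 (1 + S.hardeningSINR P h w k)

end CellFreeSystem

end

/-! Fix an access point `l` and a user `k`. Despreading by `Φ` turns the pilot signal into columns
with pairwise uncorrelated Gaussian entries: column `i` contains `τ √p_t h_t` for the users of pilot
`i` only, plus noise, and has entry variance `hbarVar`. The MMSE coefficient `c` makes the error `e
= h_k - ĥ_k` uncorrelated with every column. Uncorrelated linear forms in independent complex
Gaussians are independent (`hasLaw_pi_complexGaussian_of_orthogonal`), so `e` is independent of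
`Hbar`, and these arrays are independent across access points (`IsRayleigh.hasLaw_errorCols_pi`).

Now split `h_kᴴ w` along `h_k = c · (column i_k) + e`. Zero forcing makes the first part a constant,
nonzero only for a shared pilot. Given the precoder, the second part is centred with variance `(β -
γ) ‖w‖²`; since `w` has unit mean square, its variance is `β - γ` whichever precoder is used
(`IsRayleigh.gain_ae_eq`, `IsRayleigh.moments_gainFluctuation`). Over the access points the
constants add coherently and the variances add; the SINR follows.

The constant needs the mean power of the zero-forcing direction `z_i`. It is a multiple of the
projection of column `i` onto the orthogonal complement of the other columns, scaled to have inner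
product 1 with column `i`, so `‖z_i‖²` is the inverse squared norm of that projection. The
complement has dimension `M - τ + 1`, and `n` independent `CN(0, v)` coordinates have mean inverse
squared norm `1 / (v (n - 1))`. This gives `1 / (hbarVar · (M - τ))`, finite because `τ < M`. -/

/-! ### Transforms and moments of the complex Gaussian law -/

instance (v : ℝ) : IsProbabilityMeasure (complexGaussian v) :=
  Measure.isProbabilityMeasure_map (by fun_prop)

theorem charFun_complexGaussian {v : ℝ} (hv : 0 ≤ v) (t : ℂ) :
    charFun (complexGaussian v) t = Complex.exp (-(v * ‖t‖ ^ 2 / 4 : ℝ)) := by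
  have h1 : ∀ x : ℝ × ℝ, Complex.exp (inner ℝ ((x.1 : ℂ) + (x.2 : ℂ) * Complex.I) t * Complex.I) =
      Complex.exp (t.re * x.1 * Complex.I) * Complex.exp (t.im * x.2 * Complex.I) := by
    intro x
    rw [← Complex.exp_add, Complex.inner]
    congr 1
    simp
    ring
  rw [charFun_apply, complexGaussian, integral_map (by fun_prop) (by fun_prop)]
  simp_rw [h1]
  rw [integral_prod_mul (fun x : ℝ => Complex.exp (t.re * x * Complex.I))
    (fun x : ℝ => Complex.exp (t.im * x * Complex.I)), ← charFun_apply_real, ← charFun_apply_real,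
    charFun_gaussianReal, charFun_gaussianReal, ← Complex.exp_add]
  congr 1
  have h2 : (((v / 2).toNNReal : NNReal) : ℂ) = (v / 2 : ℝ) := by
    rw [← Real.coe_toNNReal (v / 2) (by positivity), Real.toNNReal_coe]
  rw [h2, ← Complex.normSq_eq_norm_sq, Complex.normSq_apply]
  push_cast
  ring

theorem lintegral_exp_neg_sq_gaussianReal {v : NNReal} (hv : v ≠ 0) {s : ℝ} (hs : 0 ≤ s) :
    ∫⁻ x, ENNReal.ofReal (Real.exp (-(s * x ^ 2))) ∂gaussianReal 0 v =
      ENNReal.ofReal (√(1 + 2 * s * v))⁻¹ := by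
  have hv' : (0 : ℝ) < v := by positivity
  rw [← ofReal_integral_eq_lintegral_ofReal _ (ae_of_all _ fun x => (Real.exp_pos _).le),
    integral_gaussianReal_eq_integral_smul hv]
  · congr 1
    have h1 : ∀ x : ℝ, gaussianPDFReal 0 v x • Real.exp (-(s * x ^ 2)) =
        (√(2 * Real.pi * v))⁻¹ * Real.exp (-((1 + 2 * s * v) / (2 * v)) * x ^ 2) := by
      intro x
      rw [gaussianPDFReal, smul_eq_mul, mul_assoc, ← Real.exp_add]
      congr 2
      field_simp
      ring
    simp_rw [h1]
    rw [integral_const_mul, integral_gaussian, ← Real.sqrt_inv, ← Real.sqrt_inv,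
      ← Real.sqrt_mul (by positivity)]
    congr 1
    have : 1 + 2 * s * (v : ℝ) ≠ 0 := by positivity
    field_simp
  · refine Integrable.of_bound (C := 1) (by fun_prop) (ae_of_all _ fun x => ?_)
    rw [Real.norm_eq_abs, Real.abs_exp, Real.exp_le_one_iff]
    nlinarith [mul_nonneg hs (sq_nonneg x)]

theorem lintegral_exp_neg_normSq_complexGaussian {v s : ℝ} (hv : 0 < v) (hs : 0 ≤ s) :
    ∫⁻ z, ENNReal.ofReal (Real.exp (-(s * ‖z‖ ^ 2))) ∂complexGaussian v =
      ENNReal.ofReal (1 + s * v)⁻¹ := by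
  rw [complexGaussian, lintegral_map (by fun_prop) (by fun_prop)]
  have h1 : ∀ x : ℝ × ℝ,
      ENNReal.ofReal (Real.exp (-(s * ‖(x.1 : ℂ) + (x.2 : ℂ) * Complex.I‖ ^ 2))) =
      ENNReal.ofReal (Real.exp (-(s * x.1 ^ 2))) * ENNReal.ofReal (Real.exp (-(s * x.2 ^ 2))) := by
    intro x
    rw [← ENNReal.ofReal_mul (Real.exp_pos _).le, ← Real.exp_add, ← Complex.normSq_eq_norm_sq,
      Complex.normSq_add_mul_I]
    congr 2
    ring
  simp_rw [h1]
  have hv2 : (v / 2).toNNReal ≠ 0 := by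
    rw [Ne, Real.toNNReal_eq_zero]
    linarith
  have hpos : 0 ≤ 1 + s * v := by positivity
  rw [lintegral_prod_mul (f := fun x : ℝ => ENNReal.ofReal (Real.exp (-(s * x ^ 2))))
    (g := fun x : ℝ => ENNReal.ofReal (Real.exp (-(s * x ^ 2)))) (by fun_prop) (by fun_prop),
    lintegral_exp_neg_sq_gaussianReal hv2 hs, ← ENNReal.ofReal_mul (by positivity),
    Real.coe_toNNReal _ (by positivity), show 1 + 2 * s * (v / 2) = 1 + s * v by ring,
    ← mul_inv, Real.mul_self_sqrt hpos]

theorem memLp_id_complexGaussian (v : ℝ) : MemLp id 2 (complexGaussian v) := by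
  have hg : MemLp id 2 (gaussianReal 0 (v / 2).toNNReal) := by
    simpa using memLp_id_gaussianReal (μ := 0) (v := (v / 2).toNNReal) 2
  rw [complexGaussian, memLp_map_measure_iff (by fun_prop) (by fun_prop)]
  have h1 := (hg.comp_measurePreserving
    (measurePreserving_fst (ν := gaussianReal 0 (v / 2).toNNReal))).ofReal (K := ℂ)
  have h2 := (hg.comp_measurePreserving
    (measurePreserving_snd (μ := gaussianReal 0 (v / 2).toNNReal))).ofReal (K := ℂ)
  exact h1.add (h2.mul_const Complex.I)

theorem integral_id_complexGaussian (v : ℝ) : ∫ z, z ∂complexGaussian v = 0 := by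
  have hg : MemLp id 2 (gaussianReal 0 (v / 2).toNNReal) := by
    simpa using memLp_id_gaussianReal (μ := 0) (v := (v / 2).toNNReal) 2
  have hi := hg.integrable one_le_two
  have m1 := measurePreserving_fst (μ := gaussianReal 0 (v / 2).toNNReal)
    (ν := gaussianReal 0 (v / 2).toNNReal)
  have m2 := measurePreserving_snd (μ := gaussianReal 0 (v / 2).toNNReal)
    (ν := gaussianReal 0 (v / 2).toNNReal)
  have h1 : Integrable (fun x : ℝ × ℝ => (x.1 : ℂ)) ((gaussianReal 0 (v / 2).toNNReal).prod
      (gaussianReal 0 (v / 2).toNNReal)) := (m1.integrable_comp_of_integrable hi).ofReal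
  have h2 : Integrable (fun x : ℝ × ℝ => (x.2 : ℂ)) ((gaussianReal 0 (v / 2).toNNReal).prod
      (gaussianReal 0 (v / 2).toNNReal)) := (m2.integrable_comp_of_integrable hi).ofReal
  rw [complexGaussian, integral_map (by fun_prop) (by fun_prop), integral_add h1 (h2.mul_const _),
    integral_mul_const, integral_fun_fst (fun x : ℝ => (x : ℂ)),
    integral_fun_snd (fun x : ℝ => (x : ℂ)), integral_complex_ofReal]
  simp

theorem integral_normSq_complexGaussian {v : ℝ} (hv : 0 ≤ v) :
    ∫ z, ‖z‖ ^ 2 ∂complexGaussian v = v := by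
  have hg : MemLp id 2 (gaussianReal 0 (v / 2).toNNReal) := by
    simpa using memLp_id_gaussianReal (μ := 0) (v := (v / 2).toNNReal) 2
  have hi : Integrable (fun x : ℝ => x ^ 2) (gaussianReal 0 (v / 2).toNNReal) := hg.integrable_sq
  have m1 := measurePreserving_fst (μ := gaussianReal 0 (v / 2).toNNReal)
    (ν := gaussianReal 0 (v / 2).toNNReal)
  have m2 := measurePreserving_snd (μ := gaussianReal 0 (v / 2).toNNReal)
    (ν := gaussianReal 0 (v / 2).toNNReal)
  have h1 := m1.integrable_comp_of_integrable hi
  have h2 := m2.integrable_comp_of_integrable hi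
  have h3 : ∫ x, x ^ 2 ∂gaussianReal 0 (v / 2).toNNReal = v / 2 := by
    have h := variance_id_gaussianReal (μ := 0) (v := (v / 2).toNNReal)
    rw [variance_of_integral_eq_zero (by fun_prop) (by simp), Real.coe_toNNReal _ (by positivity)] at h
    exact h
  rw [complexGaussian, integral_map (by fun_prop) (by fun_prop)]
  simp_rw [← Complex.normSq_eq_norm_sq, Complex.normSq_add_mul_I]
  rw [integral_add (f := fun x : ℝ × ℝ => x.1 ^ 2) (g := fun x : ℝ × ℝ => x.2 ^ 2) h1 h2,
    integral_fun_fst (fun x : ℝ => x ^ 2), integral_fun_snd (fun x : ℝ => x ^ 2), h3]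
  simp

/-! ### Uncorrelated linear forms in complex Gaussians -/

/-- Linear forms in independent complex Gaussians that are pairwise uncorrelated are independent
complex Gaussians. -/
theorem hasLaw_pi_complexGaussian_of_orthogonal {Ω I J : Type*} [MeasurableSpace Ω] {P : Measure Ω}
    [IsProbabilityMeasure P] [Fintype I] [DecidableEq I] [Fintype J] {X : J → Ω → ℂ} {v : J → ℝ}
    (hv : ∀ j, 0 ≤ v j)
    (hX : ∀ j, HasLaw (X j) (complexGaussian (v j)) P) (hind : iIndepFun X P) (A : I → J → ℂ)
    {s : I → ℝ} (hs : ∀ i, 0 ≤ s i)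
    (hA : ∀ i i', ∑ j, A i j * star (A i' j) * v j = if i = i' then (s i : ℂ) else 0) :
    HasLaw (fun ω i => ∑ j, A i j * X j ω) (Measure.pi fun i => complexGaussian (s i)) P := by
  have hm : ∀ j, AEMeasurable (X j) P := fun j => (hX j).aemeasurable
  have hYm : AEMeasurable (fun ω i => ∑ j, A i j * X j ω) P := by fun_prop
  refine ⟨hYm, ?_⟩
  have := Measure.isProbabilityMeasure_map hYm
  -- At `t`, the characteristic function of the forms is that of `X` at `Aᴴ t`; the Gaussian
  -- exponent there is a Hermitian form in `t`, which `hA` makes diagonal.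
  rw [← charFun_eq_pi_iff]
  intro t
  have hXj := charFun_pi (μ := fun j => complexGaussian (v j))
    (WithLp.toLp 2 fun j => ∑ i, star (A i j) * t.ofLp i)
  rw [← (iIndepFun.hasLaw_pi hX hind).map_eq] at hXj
  rw [charFun_apply, integral_map (by fun_prop) (by fun_prop),
    integral_map (by fun_prop) (by fun_prop)] at hXj ⊢
  have hinner : ∀ ω, inner ℝ (WithLp.toLp 2 fun i => ∑ j, A i j * X j ω) t =
      inner ℝ (WithLp.toLp 2 fun j => X j ω)
        (WithLp.toLp 2 fun j => ∑ i, star (A i j) * t.ofLp i) := by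
    intro ω
    simp only [PiLp.inner_apply, Complex.inner, map_sum, map_mul, Finset.mul_sum, Finset.sum_mul,
      ← Complex.re_sum]
    rw [Finset.sum_comm]
    congr 1
    refine Finset.sum_congr rfl fun j _ => Finset.sum_congr rfl fun i _ => ?_
    simp only [RCLike.star_def]
    ring
  simp_rw [hinner, hXj, charFun_complexGaussian (hv _), charFun_complexGaussian (hs _),
    ← Complex.exp_sum]
  congr 1
  simp only [Finset.sum_neg_distrib]
  congr 1
  have hn : ∀ (a : ℝ) (z : ℂ), ((a * ‖z‖ ^ 2 / 4 : ℝ) : ℂ) = a * (z * star z) / 4 := by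
    intro a z
    rw [RCLike.star_def, Complex.mul_conj']
    push_cast
    ring
  simp_rw [hn, star_sum, star_mul, star_star, Finset.sum_mul_sum, Finset.mul_sum, Finset.sum_div]
  rw [Finset.sum_comm]
  refine Finset.sum_congr rfl fun i _ => ?_
  rw [Finset.sum_comm]
  calc ∑ i', ∑ j, (v j : ℂ) * (star (A i j) * t.ofLp i * (star (t.ofLp i') * A i' j)) / 4
      = ∑ i', (t.ofLp i * star (t.ofLp i')) / 4 *
          ∑ j, A i' j * star (A i j) * v j := by
        refine Finset.sum_congr rfl fun i' _ => ?_
        rw [Finset.mul_sum]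
        exact Finset.sum_congr rfl fun j _ => by ring
    _ = _ := by
        simp_rw [hA]
        simp
        ring

/-! ### Inverse moments of squared norms -/

theorem lintegral_Ioi_exp_neg_mul {q : ℝ} (hq : 0 ≤ q) :
    ∫⁻ s in Set.Ioi (0 : ℝ), ENNReal.ofReal (Real.exp (-(s * q))) = (ENNReal.ofReal q)⁻¹ := by
  rcases hq.eq_or_lt with rfl | hq
  -- At `q = 0` both sides are `∞`, so no positivity is needed below.
  · simp
  · have h1 : ∀ s : ℝ, -(s * q) = -q * s := fun s => by ring
    simp_rw [h1]
    rw [← ofReal_integral_eq_lintegral_ofReal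
      (integrableOn_exp_mul_Ioi (by linarith) 0) (ae_of_all _ fun x => (Real.exp_pos _).le),
      integral_exp_mul_Ioi (by linarith), ← ENNReal.ofReal_inv_of_pos hq]
    congr 1
    simp

theorem lintegral_Ioi_inv_one_add_mul_pow {v : ℝ} (hv : 0 < v) {n : ℕ} (hn : 0 < n) :
    ∫⁻ s in Set.Ioi (0 : ℝ), ENNReal.ofReal ((1 + s * v)⁻¹ ^ (n + 1)) =
      ENNReal.ofReal (v * n)⁻¹ := by
  have hn' : (0 : ℝ) < n := by exact_mod_cast hn
  have hder : ∀ s ∈ Set.Ici (0 : ℝ), HasDerivAt (fun s : ℝ => -((1 + s * v)⁻¹ ^ n * (v * n)⁻¹))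
      ((1 + s * v)⁻¹ ^ (n + 1)) s := by
    intro s hs
    have hs' : 0 < 1 + s * v := by
      have : 0 ≤ s := hs
      positivity
    have h1 : HasDerivAt (fun s : ℝ => 1 + s * v) v s := by
      simpa using ((hasDerivAt_id s).mul_const v).const_add 1
    convert! (((h1.fun_inv hs'.ne').fun_pow n).mul_const (v * n)⁻¹).neg using 1
    obtain ⟨m, rfl⟩ := Nat.exists_eq_succ_of_ne_zero hn.ne'
    simp only [Nat.succ_eq_add_one, Nat.add_sub_cancel]
    have h2 := hn'.ne'
    have h3 := hs'.ne'
    simp only [inv_pow]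
    field_simp
    ring
  have hnn : ∀ s ∈ Set.Ioi (0 : ℝ), 0 ≤ (1 + s * v)⁻¹ ^ (n + 1) := by
    intro s hs
    have : 0 < s := hs
    positivity
  have htend : Filter.Tendsto (fun s : ℝ => -((1 + s * v)⁻¹ ^ n * (v * n)⁻¹)) Filter.atTop
      (nhds 0) := by
    have h1 : Filter.Tendsto (fun s : ℝ => 1 + s * v) Filter.atTop Filter.atTop :=
      Filter.tendsto_atTop_add_const_left _ _ (Filter.tendsto_id.atTop_mul_const hv)
    have h2 := ((h1.inv_tendsto_atTop.pow n).mul_const (v * n)⁻¹).neg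
    simpa [hn.ne'] using h2
  rw [← ofReal_integral_eq_lintegral_ofReal (integrableOn_Ioi_deriv_of_nonneg' hder hnn htend)
    (ae_restrict_of_forall_mem measurableSet_Ioi hnn),
    integral_Ioi_of_hasDerivAt_of_nonneg' hder hnn htend]
  simp

/-- Write `1/q = ∫ e^{-sq} ds` and exchange integrals: by independence the inner one is `(1 + s
v)⁻ⁿ`, whose integral over `s > 0` converges exactly when `n ≥ 2`. -/
theorem lintegral_inv_sum_normSq_complexGaussian {v : ℝ} (hv : 0 < v) {n : ℕ} (hn : 2 ≤ n) :
    ∫⁻ y, (ENNReal.ofReal (∑ j, ‖y j‖ ^ 2))⁻¹ ∂Measure.pi (fun _ : Fin n => complexGaussian v) =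
      ENNReal.ofReal (v * (n - 1))⁻¹ := by
  obtain ⟨n, rfl⟩ : ∃ k, n = k + 1 := ⟨n - 1, by omega⟩
  have hnn : ∀ y : Fin (n + 1) → ℂ, 0 ≤ ∑ j, ‖y j‖ ^ 2 := fun y => by positivity
  simp_rw [← lintegral_Ioi_exp_neg_mul (hnn _)]
  rw [lintegral_lintegral_swap (by fun_prop)]
  have h1 : ∀ s ∈ Set.Ioi (0 : ℝ), ∫⁻ y : Fin (n + 1) → ℂ, ENNReal.ofReal
      (Real.exp (-(s * ∑ j, ‖y j‖ ^ 2))) ∂Measure.pi (fun _ => complexGaussian v) =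
      ENNReal.ofReal ((1 + s * v)⁻¹ ^ (n + 1)) := by
    intro s hs
    have hs' : 0 < s := hs
    have h2 : ∀ y : Fin (n + 1) → ℂ, ENNReal.ofReal (Real.exp (-(s * ∑ j, ‖y j‖ ^ 2))) =
        ∏ j, ENNReal.ofReal (Real.exp (-(s * ‖y j‖ ^ 2))) := by
      intro y
      rw [← ENNReal.ofReal_prod_of_nonneg fun j _ => (Real.exp_pos _).le, ← Real.exp_sum,
        Finset.mul_sum, Finset.sum_neg_distrib]
    simp_rw [h2]
    rw [lintegral_prod_eq_prod_lintegral_of_indepFun Finset.univ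
      (fun (j : Fin (n + 1)) (y : Fin (n + 1) → ℂ) =>
        ENNReal.ofReal (Real.exp (-(s * ‖y j‖ ^ 2))))
      (iIndepFun_pi (X := fun _ z => ENNReal.ofReal (Real.exp (-(s * ‖z‖ ^ 2))))
        fun _ => by fun_prop) (fun _ => by fun_prop)]
    have h3 : ∀ j : Fin (n + 1), ∫⁻ y : Fin (n + 1) → ℂ,
        ENNReal.ofReal (Real.exp (-(s * ‖y j‖ ^ 2))) ∂Measure.pi (fun _ => complexGaussian v) =
        ENNReal.ofReal (1 + s * v)⁻¹ := fun j => by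
      rw [← lintegral_exp_neg_normSq_complexGaussian hv hs'.le,
        ← (measurePreserving_eval (fun _ : Fin (n + 1) => complexGaussian v) j).lintegral_comp
          (by fun_prop)]
    simp_rw [h3]
    rw [Finset.prod_const, Finset.card_univ, Fintype.card_fin, ENNReal.ofReal_pow (by positivity)]
  rw [setLIntegral_congr_fun measurableSet_Ioi h1,
    lintegral_Ioi_inv_one_add_mul_pow hv (by omega)]
  simp

/-- In an orthonormal basis of `U` the coordinates of the projection are again independent `CN(0,
v)`, so only the dimension of `U` matters. -/
theorem lintegral_inv_normSq_starProjection {M : ℕ} {v : ℝ} (hv : 0 < v)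
    (U : Submodule ℂ (EuclideanSpace ℂ (Fin M))) (hU : 2 ≤ Module.finrank ℂ U) :
    ∫⁻ x, (ENNReal.ofReal (‖U.starProjection (WithLp.toLp 2 x)‖ ^ 2))⁻¹
        ∂Measure.pi (fun _ : Fin M => complexGaussian v) =
      ENNReal.ofReal (v * (Module.finrank ℂ U - 1))⁻¹ := by
  let b := stdOrthonormalBasis ℂ U
  have hlaw := hasLaw_pi_complexGaussian_of_orthogonal
    (P := Measure.pi (fun _ : Fin M => complexGaussian v)) (X := fun m x => x m)
    (v := fun _ => v) (fun _ => hv.le)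
    (fun m => (measurePreserving_eval (fun _ : Fin M => complexGaussian v) m).hasLaw)
    (iIndepFun_pi (X := fun _ => id) (fun _ => aemeasurable_id))
    (fun j m => star ((b j : EuclideanSpace ℂ (Fin M)) m))
    (s := fun _ => v) (fun _ => hv.le) (by
      intro i i'
      rw [← Finset.sum_mul]
      have h := orthonormal_iff_ite.1 b.orthonormal i i'
      rw [Submodule.coe_inner, EuclideanSpace.inner_eq_star_dotProduct, dotProduct] at h
      simp_rw [star_star]
      have h2 : ∑ x, star ((b i : EuclideanSpace ℂ (Fin M)) x) *
          (b i' : EuclideanSpace ℂ (Fin M)) x = if i = i' then 1 else 0 := by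
        rw [← h]
        exact Finset.sum_congr rfl fun x _ => by rw [mul_comm]; rfl
      rw [h2]
      split_ifs <;> simp)
  rw [← lintegral_inv_sum_normSq_complexGaussian hv hU, ← hlaw.map_eq,
    lintegral_map' (Measurable.aemeasurable (by fun_prop)) hlaw.aemeasurable]
  refine lintegral_congr fun x => ?_
  congr 2
  rw [Submodule.starProjection_apply, ← Submodule.coe_norm, ← b.sum_sq_norm_inner_right]
  refine Finset.sum_congr rfl fun j _ => ?_
  rw [Submodule.inner_orthogonalProjectionOnto_eq_of_mem_left,
    EuclideanSpace.inner_eq_star_dotProduct, dotProduct]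
  congr 2
  exact Finset.sum_congr rfl fun x _ => by rw [mul_comm]; rfl

/-- On `W` the projection onto `Wᗮ` vanishes and its inverse squared norm is `∞`, which a finite
integral excludes almost surely. Dimension two, rather than one, is what makes that integral finite.
-/
theorem ae_notMem_of_two_le_finrank_orthogonal {M : ℕ} {v : ℝ} (hv : 0 < v)
    (W : Submodule ℂ (EuclideanSpace ℂ (Fin M))) (hW : 2 ≤ Module.finrank ℂ Wᗮ) :
    ∀ᵐ x ∂Measure.pi (fun _ : Fin M => complexGaussian v), WithLp.toLp 2 x ∉ W := by
  have h := lintegral_inv_normSq_starProjection hv Wᗮ hW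
  have h2 := ae_lt_top' (by fun_prop) (h.trans_ne ENNReal.ofReal_ne_top)
  filter_upwards [h2] with x hx hxW
  rw [Submodule.starProjection_apply,
    Submodule.orthogonalProjectionOnto_orthogonal_apply_eq_zero hxW] at hx
  simp at hx

/-! ### Algebra and geometry of zero forcing -/

/-- The zero-forcing direction `G (Gᴴ G)⁻¹ e_i` of a channel matrix `G`. -/
noncomputable def zfVector {M τ : ℕ} (G : Matrix (Fin M) (Fin τ) ℂ) (i : Fin τ) : Fin M → ℂ :=
  (G * (Gᴴ * G)⁻¹) *ᵥ Pi.single i 1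

/-- The matrix with prescribed columns. -/
def ofCols {M τ : ℕ} (g : Fin τ → Fin M → ℂ) : Matrix (Fin M) (Fin τ) ℂ :=
  Matrix.of fun m i => g i m

theorem measurable_zfVector {M τ : ℕ} (i : Fin τ) :
    Measurable fun g : Fin τ → Fin M → ℂ => zfVector (ofCols g) i := by
  have hc : Continuous fun g : Fin τ → Fin M → ℂ => ofCols g := by
    refine continuous_matrix fun m j => ?_
    simp only [ofCols, Matrix.of_apply]
    fun_prop
  have hG : Continuous fun g : Fin τ → Fin M → ℂ => (ofCols g)ᴴ * ofCols g :=
    hc.matrix_conjTranspose.matrix_mul hc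
  -- With `0⁻¹ = 0` the adjugate formula also covers singular Gram matrices, where the matrix
  -- inverse is zero by convention.
  have h1 : ∀ g : Fin τ → Fin M → ℂ, zfVector (ofCols g) i =
      ((ofCols g)ᴴ * ofCols g).det⁻¹ •
        ((ofCols g * ((ofCols g)ᴴ * ofCols g).adjugate) *ᵥ Pi.single i 1) := by
    intro g
    rw [zfVector, Matrix.inv_def, Ring.inverse_eq_inv', Matrix.mul_smul, Matrix.smul_mulVec]
  simp_rw [h1]
  exact (hG.matrix_det.measurable.inv).smul
    ((hc.matrix_mul hG.matrix_adjugate).matrix_mulVec continuous_const).measurable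

theorem measurable_vecNormSq {M : ℕ} : Measurable (vecNormSq (M := M)) := by
  unfold vecNormSq
  fun_prop

theorem vecNormSq_nonneg {M : ℕ} (x : Fin M → ℂ) : 0 ≤ vecNormSq x := by
  unfold vecNormSq
  positivity

theorem vecNormSq_eq_norm_toLp {M : ℕ} (x : Fin M → ℂ) : vecNormSq x = ‖WithLp.toLp 2 x‖ ^ 2 := by
  rw [EuclideanSpace.norm_sq_eq]
  rfl

theorem isUnit_det_gram {M τ : ℕ} {g : Fin τ → Fin M → ℂ} (hg : LinearIndependent ℂ g) :
    IsUnit ((ofCols g)ᴴ * ofCols g).det := by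
  have h : Function.Injective (ofCols g).mulVec := Matrix.mulVec_injective_iff.2 hg
  open scoped ComplexOrder in
  exact (Matrix.PosDef.conjTranspose_mul_self _ h).det_pos.ne'.isUnit

theorem star_dotProduct_zfVector {M τ : ℕ} {g : Fin τ → Fin M → ℂ}
    (hg : IsUnit ((ofCols g)ᴴ * ofCols g).det) (j i : Fin τ) :
    star (g j) ⬝ᵥ zfVector (ofCols g) i = if j = i then 1 else 0 := by
  have h : (ofCols g)ᴴ *ᵥ zfVector (ofCols g) i = Pi.single i 1 := by
    rw [zfVector, Matrix.mulVec_mulVec, ← Matrix.mul_assoc, Matrix.mul_nonsing_inv _ hg,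
      Matrix.one_mulVec]
  have h2 := congrFun h j
  rw [Pi.single_apply] at h2
  exact h2

theorem zfVector_eq_sum {M τ : ℕ} (g : Fin τ → Fin M → ℂ) (i : Fin τ) :
    zfVector (ofCols g) i =
      ∑ j, (((ofCols g)ᴴ * ofCols g)⁻¹ *ᵥ Pi.single i 1) j • g j := by
  rw [zfVector, ← Matrix.mulVec_mulVec]
  ext m
  simp only [Matrix.mulVec, dotProduct, Finset.sum_apply, Pi.smul_apply, smul_eq_mul]
  exact Finset.sum_congr rfl fun j _ => mul_comm _ _

/-- With `p` the projection of `x`, pairing `z = a p` with `p` gives `a ‖p‖² = 1`, hence `‖z‖² =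
|a|² ‖p‖² = 1 / ‖p‖²`. -/
theorem norm_sq_eq_inv_norm_sq_starProjection {E : Type*} [NormedAddCommGroup E]
    [InnerProductSpace ℂ E] {U : Submodule ℂ E} [U.HasOrthogonalProjection] {x z : E} {a : ℂ}
    (hz : z ∈ U) (hxz : inner ℂ x z = 1) (ha : z = a • U.starProjection x) :
    ‖z‖ ^ 2 = (‖U.starProjection x‖ ^ 2)⁻¹ := by
  have h1 : inner ℂ (U.starProjection x) z = 1 := by
    rw [Submodule.inner_starProjection_left_eq_right, Submodule.starProjection_eq_self_iff.2 hz, hxz]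
  rw [ha, inner_smul_right, inner_self_eq_norm_sq_to_K] at h1
  have h2 := congrArg norm h1
  rw [norm_mul, norm_pow, norm_one, RCLike.norm_ofReal, abs_norm] at h2
  refine eq_inv_of_mul_eq_one_left ?_
  rw [ha, norm_smul]
  linear_combination (‖a‖ * ‖U.starProjection x‖ ^ 2 + 1) * h2

/-- The span of the given vectors in the Euclidean space. -/
noncomputable def euclideanSpan {M n : ℕ} (r : Fin n → Fin M → ℂ) :
    Submodule ℂ (EuclideanSpace ℂ (Fin M)) :=
  Submodule.span ℂ (Set.range fun j => WithLp.toLp 2 (r j))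

theorem linearIndependent_toLp {M n : ℕ} {r : Fin n → Fin M → ℂ} :
    LinearIndependent ℂ (fun j => (WithLp.toLp 2 (r j) : EuclideanSpace ℂ (Fin M))) ↔
      LinearIndependent ℂ r :=
  LinearMap.linearIndependent_iff (WithLp.linearEquiv 2 ℂ (Fin M → ℂ)).symm.toLinearMap
    (LinearEquiv.ker _)

theorem finrank_orthogonal_euclideanSpan {M n : ℕ} {r : Fin n → Fin M → ℂ}
    (hr : LinearIndependent ℂ r) : Module.finrank ℂ (euclideanSpan r)ᗮ + n = M := by
  have h1 := (euclideanSpan r).finrank_add_finrank_orthogonal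
  rw [euclideanSpan, finrank_span_eq_card (linearIndependent_toLp.2 hr)] at h1
  simp only [finrank_euclideanSpace, Fintype.card_fin] at h1
  rw [euclideanSpan]
  omega

/-! ### Gaussian columns and the mean zero-forcing power -/

theorem ae_linearIndependent_complexGaussian {M n : ℕ} (hn : n < M) {v : Fin n → ℝ}
    (hv : ∀ i, 0 < v i) :
    ∀ᵐ g ∂Measure.pi fun i : Fin n => Measure.pi fun _ : Fin M => complexGaussian (v i),
      LinearIndependent ℂ g := by
  induction n with
  | zero => exact ae_of_all _ fun g => linearIndependent_empty_type
  | succ n ih =>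
    have hmp := measurePreserving_piFinSuccAbove
      (fun i : Fin (n + 1) => Measure.pi fun _ : Fin M => complexGaussian (v i)) 0
    have h1 := ih (by omega) fun i => hv (Fin.succ i)
    have hmeas : MeasurableSet {q : (Fin M → ℂ) × (Fin n → Fin M → ℂ) |
        LinearIndependent ℂ (Fin.cons q.1 q.2 : Fin (n + 1) → Fin M → ℂ)} := by
      have ho : IsOpen {g : Fin (n + 1) → Fin M → ℂ | LinearIndependent ℂ g} :=
        isOpen_setOfPred_linearIndependent
      refine ho.measurableSet.preimage (f := fun q : (Fin M → ℂ) × (Fin n → Fin M → ℂ) =>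
        (Fin.cons q.1 q.2 : Fin (n + 1) → Fin M → ℂ)) ?_
      exact Continuous.measurable (by fun_prop)
    have h2 : ∀ᵐ q ∂(Measure.pi fun _ : Fin M => complexGaussian (v 0)).prod
        (Measure.pi fun i : Fin n => Measure.pi fun _ : Fin M => complexGaussian (v i.succ)),
        LinearIndependent ℂ (Fin.cons q.1 q.2 : Fin (n + 1) → Fin M → ℂ) := by
      -- The swap fixes the other columns first, so that the new column is tested against a fixed
      -- span.
      rw [← Measure.prod_swap, ae_map_iff (by fun_prop) hmeas]
      refine (Measure.ae_prod_iff_ae_ae (p := fun q : (Fin n → Fin M → ℂ) × (Fin M → ℂ) =>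
        LinearIndependent ℂ (Fin.cons q.2 q.1 : Fin (n + 1) → Fin M → ℂ))
        (measurable_swap hmeas)).2 ?_
      filter_upwards [h1] with r hr
      filter_upwards [ae_notMem_of_two_le_finrank_orthogonal (hv 0) (euclideanSpan r)
        (by have := finrank_orthogonal_euclideanSpan hr; omega)] with x hx
      have h3 := linearIndependent_finCons.2 ⟨linearIndependent_toLp.2 hr, hx⟩
      rw [← linearIndependent_toLp]
      convert! h3 using 1
      ext j
      refine Fin.cases ?_ (fun j => ?_) j <;> simp
    have h4 := hmp.quasiMeasurePreserving.ae h2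
    filter_upwards [h4] with g hg
    convert! hg using 1
    exact (Fin.cons_self_tail g).symm

/-- The direction is orthogonal to every `r j`, has inner product 1 with `x`, and lies in the span
of all the columns. Projecting that expansion onto the complement of the `r j` leaves only the
multiple of `x`. -/
theorem vecNormSq_zfVector_insertNth {M n : ℕ} (i : Fin (n + 1)) (x : Fin M → ℂ)
    (r : Fin n → Fin M → ℂ)
    (hg : LinearIndependent ℂ (i.insertNth x r : Fin (n + 1) → Fin M → ℂ)) :
    vecNormSq (zfVector (ofCols (i.insertNth x r)) i) =
      (‖(euclideanSpan r)ᗮ.starProjection (WithLp.toLp 2 x)‖ ^ 2)⁻¹ := by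
  set g : Fin (n + 1) → Fin M → ℂ := i.insertNth x r with hgdef
  set z := zfVector (ofCols g) i with hz
  have hin := fun j => star_dotProduct_zfVector (isUnit_det_gram hg) j i
  have hx : g i = x := Fin.insertNth_apply_same (α := fun _ => Fin M → ℂ) i x r
  have hr : ∀ j, g (i.succAbove j) = r j := Fin.insertNth_apply_succAbove (α := fun _ => Fin M → ℂ) i x r
  have hzmem : WithLp.toLp 2 z ∈ (euclideanSpan r)ᗮ := by
    rw [Submodule.mem_orthogonal]
    intro u hu
    induction hu using Submodule.span_induction with
    | mem u hu =>
      obtain ⟨j, rfl⟩ := hu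
      simp only [EuclideanSpace.inner_eq_star_dotProduct]
      rw [dotProduct_comm, ← hr]
      simpa [Fin.succAbove_ne] using hin (i.succAbove j)
    | zero => simp
    | add u w _ _ hu hw => rw [inner_add_left, hu, hw, add_zero]
    | smul a u _ hu => rw [inner_smul_left, hu, mul_zero]
  rw [vecNormSq_eq_norm_toLp]
  refine norm_sq_eq_inv_norm_sq_starProjection
    (a := (((ofCols g)ᴴ * ofCols g)⁻¹ *ᵥ Pi.single i 1) i) hzmem ?_ ?_
  · rw [EuclideanSpace.inner_eq_star_dotProduct, dotProduct_comm, ← hx]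
    simpa using hin i
  · conv_lhs => rw [← Submodule.starProjection_eq_self_iff.2 hzmem, hz, zfVector_eq_sum,
      Fin.sum_univ_succAbove _ i, hx]
    rw [WithLp.toLp_add, map_add, WithLp.toLp_smul, map_smul, WithLp.toLp_sum, map_sum,
      Finset.sum_eq_zero, add_zero]
    intro j _
    rw [WithLp.toLp_smul, map_smul, hr, Submodule.starProjection_orthogonal_apply_eq_zero, smul_zero]
    exact Submodule.subset_span ⟨j, rfl⟩

/-- Conditionally on the other `τ - 1` columns, this is an inverse moment in dimension `M - τ + 1`;
its value does not depend on those columns. -/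
theorem lintegral_vecNormSq_zfVector {M τ : ℕ} (hM : τ < M) {v : Fin τ → ℝ} (hv : ∀ i, 0 < v i)
    (i : Fin τ) :
    ∫⁻ g, ENNReal.ofReal (vecNormSq (zfVector (ofCols g) i))
      ∂Measure.pi (fun j : Fin τ => Measure.pi fun _ : Fin M => complexGaussian (v j)) =
      ENNReal.ofReal (v i * (M - τ))⁻¹ := by
  obtain ⟨n, rfl⟩ : ∃ n, τ = n + 1 := ⟨τ - 1, by have := i.2; omega⟩
  have hmp := (measurePreserving_piFinSuccAbove
      (fun i : Fin (n + 1) => Measure.pi fun _ : Fin M => complexGaussian (v i)) i).symm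
  have hmp2 := hmp.comp Measure.measurePreserving_swap
  have hmeas : Measurable fun g : Fin (n + 1) → Fin M → ℂ =>
      ENNReal.ofReal (vecNormSq (zfVector (ofCols g) i)) :=
    (measurable_vecNormSq.comp (measurable_zfVector i)).ennreal_ofReal
  have hae := hmp2.quasiMeasurePreserving.ae (ae_linearIndependent_complexGaussian hM hv)
  have h1 := Measure.ae_ae_of_ae_prod hae
  rw [← hmp2.lintegral_comp hmeas]
  refine (lintegral_prod _ (hmeas.comp hmp2.measurable).aemeasurable).trans ?_
  have hconst : ∀ᵐ r ∂Measure.pi fun j : Fin n =>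
      Measure.pi fun _ : Fin M => complexGaussian (v (i.succAbove j)),
      ∫⁻ x, ENNReal.ofReal (vecNormSq (zfVector (ofCols (i.insertNth x r)) i))
        ∂(Measure.pi fun _ : Fin M => complexGaussian (v i)) =
      ENNReal.ofReal (v i * (M - (n + 1 : ℕ)))⁻¹ := by
    filter_upwards [h1, ae_linearIndependent_complexGaussian (by omega)
      fun j => hv (i.succAbove j)] with r hr hrli
    have hfin := finrank_orthogonal_euclideanSpan hrli
    have hd := lintegral_inv_normSq_starProjection (hv i) (euclideanSpan r)ᗮ (by omega)
    have hcast : (Module.finrank ℂ (euclideanSpan r)ᗮ : ℝ) - 1 = M - (n + 1 : ℕ) := by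
      have h2 : (Module.finrank ℂ (euclideanSpan r)ᗮ : ℝ) + n = M := by exact_mod_cast hfin
      push_cast
      linarith
    rw [← hcast, ← hd]
    have hpos := ae_notMem_of_two_le_finrank_orthogonal (hv i) (euclideanSpan r) (by omega)
    refine lintegral_congr_ae ?_
    filter_upwards [hr, hpos] with x hx hxW
    rw [vecNormSq_zfVector_insertNth i x r hx, ENNReal.ofReal_inv_of_pos]
    refine pow_pos (norm_pos_iff.2 fun h0 => hxW ?_) 2
    rw [Submodule.starProjection_apply_eq_zero_iff, Submodule.orthogonal_orthogonal] at h0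
    exact h0
  refine (lintegral_congr_ae hconst).trans ?_
  simp

/-! ### Inner products of a Gaussian vector with an independent direction -/

/-- The inner product is antilinear in `x`; the outer conjugation makes it a linear form, to which
the Gaussian law theorem applies. -/
theorem hasLaw_star_dotProduct {M : ℕ} {s : ℝ} (hs : 0 ≤ s) (z : Fin M → ℂ) :
    HasLaw (fun x : Fin M → ℂ => star (star x ⬝ᵥ z)) (complexGaussian (s * vecNormSq z))
      (Measure.pi fun _ : Fin M => complexGaussian s) := by
  have hn := vecNormSq_nonneg z
  have hlaw := hasLaw_pi_complexGaussian_of_orthogonal (I := Unit)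
    (P := Measure.pi (fun _ : Fin M => complexGaussian s)) (X := fun m x => x m)
    (v := fun _ => s) (fun _ => hs)
    (fun m => (measurePreserving_eval (fun _ : Fin M => complexGaussian s) m).hasLaw)
    (iIndepFun_pi (X := fun _ => id) (fun _ => aemeasurable_id))
    (fun _ m => star (z m)) (s := fun _ => s * vecNormSq z) (fun _ => by positivity) (by
      intro i i'
      rw [if_pos rfl, ← Finset.sum_mul, vecNormSq]
      push_cast
      rw [mul_comm]
      congr 1
      refine Finset.sum_congr rfl fun m _ => ?_
      rw [star_star, RCLike.star_def, Complex.conj_mul'])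
  have h2 := (measurePreserving_eval
    (fun _ : Unit => complexGaussian (s * vecNormSq z)) ()).hasLaw.comp hlaw
  convert! h2 using 1
  ext x
  simp [dotProduct, mul_comm]

theorem integral_star_dotProduct {M : ℕ} {s : ℝ} (hs : 0 ≤ s) (z : Fin M → ℂ) :
    ∫ x, star x ⬝ᵥ z ∂Measure.pi (fun _ : Fin M => complexGaussian s) = 0 := by
  have h := (hasLaw_star_dotProduct hs z).integral_eq
  rw [integral_id_complexGaussian] at h
  have h2 := integral_conj (𝕜 := ℂ) (μ := Measure.pi (fun _ : Fin M => complexGaussian s))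
    (f := fun x : Fin M → ℂ => star x ⬝ᵥ z)
  simpa using h2.symm.trans h

theorem memLp_star_dotProduct {M : ℕ} {s : ℝ} (hs : 0 ≤ s) (z : Fin M → ℂ) :
    MemLp (fun x : Fin M → ℂ => star x ⬝ᵥ z) 2
      (Measure.pi fun _ : Fin M => complexGaussian s) := by
  have h := hasLaw_star_dotProduct hs z
  have h2 := memLp_id_complexGaussian (s * vecNormSq z)
  rw [← h.map_eq, memLp_map_measure_iff (by fun_prop) h.aemeasurable] at h2
  refine h2.star.congr_norm (by fun_prop) (ae_of_all _ fun x => ?_)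
  simp

theorem integral_normSq_star_dotProduct {M : ℕ} {s : ℝ} (hs : 0 ≤ s) (z : Fin M → ℂ) :
    ∫ x, ‖star x ⬝ᵥ z‖ ^ 2 ∂Measure.pi (fun _ : Fin M => complexGaussian s) =
      s * vecNormSq z := by
  have hn := vecNormSq_nonneg z
  have h := (hasLaw_star_dotProduct hs z).integral_comp (f := fun w : ℂ => ‖w‖ ^ 2) (by fun_prop)
  rw [integral_normSq_complexGaussian (by positivity)] at h
  simpa [Function.comp_def] using h

theorem integrable_vecNormSq_zfVector {M τ : ℕ} (hM : τ < M) {v : Fin τ → ℝ} (hv : ∀ i, 0 < v i)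
    (i : Fin τ) :
    Integrable (fun g => vecNormSq (zfVector (ofCols g) i))
      (Measure.pi (fun j : Fin τ => Measure.pi fun _ : Fin M => complexGaussian (v j))) := by
  refine ⟨(measurable_vecNormSq.comp (measurable_zfVector i)).aestronglyMeasurable, ?_⟩
  rw [hasFiniteIntegral_iff_ofReal (ae_of_all _ fun g => vecNormSq_nonneg _),
    lintegral_vecNormSq_zfVector hM hv i]
  exact ENNReal.ofReal_lt_top

theorem integral_vecNormSq_zfVector {M τ : ℕ} (hM : τ < M) {v : Fin τ → ℝ} (hv : ∀ i, 0 < v i)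
    (i : Fin τ) :
    ∫ g, vecNormSq (zfVector (ofCols g) i)
      ∂Measure.pi (fun j : Fin τ => Measure.pi fun _ : Fin M => complexGaussian (v j)) =
      (v i * (M - τ))⁻¹ := by
  have hM' : (0 : ℝ) < M - τ := sub_pos.2 (by exact_mod_cast hM)
  have hvi := hv i
  rw [integral_eq_lintegral_of_nonneg_ae (ae_of_all _ fun g => vecNormSq_nonneg _)
    (measurable_vecNormSq.comp (measurable_zfVector i)).aestronglyMeasurable,
    lintegral_vecNormSq_zfVector hM hv i, ENNReal.toReal_ofReal (by positivity)]

/-- For fixed `y` the inner product is centred with variance `s ‖z y‖²`; integrate over the Gaussian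
vector first, then over `y`. -/
theorem moments_star_dotProduct_prod {M : ℕ} {s : ℝ} (hs : 0 ≤ s) {Y : Type*} [MeasurableSpace Y]
    (ν : Measure Y) [IsProbabilityMeasure ν] {z : Y → Fin M → ℂ} (hz : Measurable z)
    (hzi : Integrable (fun y => vecNormSq (z y)) ν) :
    MemLp (fun q : (Fin M → ℂ) × Y => star q.1 ⬝ᵥ z q.2) 2
      ((Measure.pi fun _ : Fin M => complexGaussian s).prod ν) ∧
    ∫ q, star q.1 ⬝ᵥ z q.2 ∂((Measure.pi fun _ : Fin M => complexGaussian s).prod ν) = 0 ∧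
    ∫ q, ‖star q.1 ⬝ᵥ z q.2‖ ^ 2 ∂((Measure.pi fun _ : Fin M => complexGaussian s).prod ν) =
      s * ∫ y, vecNormSq (z y) ∂ν := by
  have hmeas : Measurable (fun q : (Fin M → ℂ) × Y => star q.1 ⬝ᵥ z q.2) := by
    unfold dotProduct
    simp only [Pi.star_apply, RCLike.star_def]
    fun_prop
  have hsq : Integrable (fun q : (Fin M → ℂ) × Y => ‖star q.1 ⬝ᵥ z q.2‖ ^ 2)
      ((Measure.pi fun _ : Fin M => complexGaussian s).prod ν) := by
    rw [integrable_prod_iff' (hmeas.norm.pow_const 2).aestronglyMeasurable]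
    refine ⟨ae_of_all _ fun y => ?_, ?_⟩
    · exact (memLp_two_iff_integrable_sq_norm (by fun_prop)).1 (memLp_star_dotProduct hs (z y))
    · simp only [norm_pow, norm_norm, integral_normSq_star_dotProduct hs]
      exact hzi.const_mul _
  have hL := (memLp_two_iff_integrable_sq_norm hmeas.aestronglyMeasurable).2 hsq
  refine ⟨hL, ?_, ?_⟩
  · rw [integral_prod_symm _ (hL.integrable one_le_two)]
    simp only [integral_star_dotProduct hs, integral_zero]
  · rw [integral_prod_symm _ hsq]
    simp only [integral_normSq_star_dotProduct hs]
    exact integral_const_mul _ _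

/-- The inner product of the first column with a zero-forcing direction of the other columns. -/
noncomputable def crossGain {M τ : ℕ} (i : Fin τ) (F : Fin (τ + 1) → Fin M → ℂ) : ℂ :=
  star (F 0) ⬝ᵥ zfVector (ofCols (Fin.tail F)) i

theorem measurable_tail {M τ : ℕ} :
    Measurable fun F : Fin (τ + 1) → Fin M → ℂ => Fin.tail F := by
  unfold Fin.tail
  fun_prop

theorem measurable_crossGain {M τ : ℕ} (i : Fin τ) : Measurable (crossGain (M := M) i) := by
  have h := (measurable_zfVector (M := M) i).comp measurable_tail
  simp only [Function.comp_def] at h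
  unfold crossGain dotProduct
  simp only [Pi.star_apply, RCLike.star_def]
  fun_prop

section columns

variable {M τ : ℕ} {v : Fin (τ + 1) → ℝ}

theorem measurePreserving_tail :
    MeasurePreserving (fun F : Fin (τ + 1) → Fin M → ℂ => Fin.tail F)
      (Measure.pi fun o => Measure.pi fun _ : Fin M => complexGaussian (v o))
      (Measure.pi fun i : Fin τ => Measure.pi fun _ : Fin M => complexGaussian (v i.succ)) :=
  measurePreserving_snd.comp (measurePreserving_piFinSuccAbove
    (fun o : Fin (τ + 1) => Measure.pi fun _ : Fin M => complexGaussian (v o)) 0)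

theorem measurePreserving_head_tail :
    MeasurePreserving (fun F : Fin (τ + 1) → Fin M → ℂ => (F 0, Fin.tail F))
      (Measure.pi fun o => Measure.pi fun _ : Fin M => complexGaussian (v o))
      ((Measure.pi fun _ : Fin M => complexGaussian (v 0)).prod
        (Measure.pi fun i : Fin τ => Measure.pi fun _ : Fin M => complexGaussian (v i.succ))) :=
  measurePreserving_piFinSuccAbove
    (fun o : Fin (τ + 1) => Measure.pi fun _ : Fin M => complexGaussian (v o)) 0

/-- The zero-forcing direction depends only on the tail, which is independent of column 0. Column 0
will be the estimation error; its variance may vanish, as it does when `β l k = 0`. -/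
theorem moments_crossGain (hM : τ < M) (h0 : 0 ≤ v 0) (hv : ∀ i : Fin τ, 0 < v i.succ)
    (i : Fin τ) :
    MemLp (crossGain i) 2
      (Measure.pi fun o => Measure.pi fun _ : Fin M => complexGaussian (v o)) ∧
    ∫ F, crossGain i F ∂(Measure.pi fun o => Measure.pi fun _ : Fin M => complexGaussian (v o)) =
      0 ∧
    ∫ F, ‖crossGain i F‖ ^ 2
      ∂(Measure.pi fun o => Measure.pi fun _ : Fin M => complexGaussian (v o)) =
      v 0 * (v i.succ * (M - τ))⁻¹ := by
  obtain ⟨h1, h2, h3⟩ := moments_star_dotProduct_prod (s := v 0) h0 _ (measurable_zfVector i)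
    (integrable_vecNormSq_zfVector hM hv i)
  have hmp := measurePreserving_head_tail (M := M) (v := v)
  rw [integral_vecNormSq_zfVector hM hv i] at h3
  rw [← hmp.map_eq] at h2 h3
  rw [integral_map hmp.aemeasurable (by rw [hmp.map_eq]; exact h1.aestronglyMeasurable)] at h2
  rw [integral_map hmp.aemeasurable
    (by rw [hmp.map_eq]; exact h1.aestronglyMeasurable.norm.pow 2)] at h3
  have h4 := h1.comp_measurePreserving hmp
  simp only [Function.comp_def] at h4
  refine ⟨h4, h2, ?_⟩
  simp only [crossGain]
  exact h3

end columns

/-! ### Sums of independent terms and regrouping of product measures -/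

theorem normSq_const_add_sum_of_iIndepFun {Ω ι : Type*} [MeasurableSpace Ω] {P : Measure Ω}
    [IsProbabilityMeasure P] [Fintype ι] {X : ι → Ω → ℂ} (hL : ∀ l, MemLp (X l) 2 P)
    (h0 : ∀ l, ∫ ω, X l ω ∂P = 0) (hind : iIndepFun X P) (a : ℂ) :
    Integrable (fun ω => ‖a + ∑ l, X l ω‖ ^ 2) P ∧
    ∫ ω, ‖a + ∑ l, X l ω‖ ^ 2 ∂P = ‖a‖ ^ 2 + ∑ l, ∫ ω, ‖X l ω‖ ^ 2 ∂P := by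
  have hS : MemLp (fun ω => ∑ l, X l ω) 2 P := memLp_finsetSum _ fun l _ => hL l
  have hSi := hS.integrable one_le_two
  have hprod : ∀ l l', Integrable (fun ω => X l' ω * star (X l ω)) P :=
    fun l l' => (hL l').integrable_mul (hL l).star
  have hxy : ∀ l l', Integrable (fun ω => inner ℝ (X l ω) (X l' ω)) P := by
    intro l l'
    simp_rw [Complex.inner]
    exact (hprod l l').re
  have hcov : ∀ l l', l ≠ l' → ∫ ω, inner ℝ (X l ω) (X l' ω) ∂P = 0 := by
    intro l l' hll
    have h1 : IndepFun (X l') (fun ω => star (X l ω)) P :=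
      ((hind.indepFun hll).comp (φ := star) (ψ := id)
        (by exact continuous_star.measurable) measurable_id).symm
    have h2 := h1.integral_fun_mul_eq_mul_integral (hL l').aestronglyMeasurable
      (hL l).star.aestronglyMeasurable
    rw [h0 l', zero_mul] at h2
    have h4 := integral_re (𝕜 := ℂ) (hprod l l')
    rw [h2] at h4
    simp_rw [Complex.inner]
    simpa using h4
  have hsum : ∀ ω, ‖∑ l, X l ω‖ ^ 2 = ∑ l, ∑ l', inner ℝ (X l ω) (X l' ω) := by
    intro ω
    rw [← real_inner_self_eq_norm_sq, sum_inner]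
    simp_rw [inner_sum]
  have hexp : ∀ ω, ‖a + ∑ l, X l ω‖ ^ 2 =
      ‖a‖ ^ 2 + 2 * inner ℝ a (∑ l, X l ω) + ‖∑ l, X l ω‖ ^ 2 := fun ω => norm_add_sq_real _ _
  have i1 : Integrable (fun ω => 2 * inner ℝ a (∑ l, X l ω)) P := (hSi.const_inner a).const_mul 2
  have i2 : Integrable (fun ω => ‖∑ l, X l ω‖ ^ 2) P := hS.norm.integrable_sq
  simp_rw [hexp]
  refine ⟨((integrable_const _).add i1).add i2, ?_⟩
  rw [integral_add (f := fun ω => ‖a‖ ^ 2 + 2 * inner ℝ a (∑ l, X l ω))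
    ((integrable_const _).add i1) i2, integral_add (integrable_const _) i1,
    integral_const_mul, integral_inner hSi, integral_finsetSum _ fun l _ =>
    (hL l).integrable one_le_two]
  simp_rw [h0, hsum]
  rw [integral_finsetSum _ fun l _ => integrable_finsetSum _ fun l' _ => hxy l l']
  simp only [Finset.sum_const_zero, inner_zero_right, mul_zero, add_zero, integral_const,
    probReal_univ, smul_eq_mul, one_mul]
  congr 1
  refine Finset.sum_congr rfl fun l _ => ?_
  rw [integral_finsetSum _ fun l' _ => hxy l l', Finset.sum_eq_single l
    (fun l' _ h => hcov l l' h.symm) (by simp)]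
  simp_rw [real_inner_self_eq_norm_sq]

theorem pi_map_curry {ι κ X : Type*} [Fintype ι] [Fintype κ] [MeasurableSpace X]
    (μ : ι → κ → Measure X) [∀ i j, IsProbabilityMeasure (μ i j)] :
    (Measure.pi fun p : ι × κ => μ p.1 p.2).map (fun f i j => f (i, j)) =
      Measure.pi fun i => Measure.pi fun j => μ i j := by
  have h := Measure.infinitePi_map_curry μ
  simp only [Measure.infinitePi_eq_pi] at h
  exact h

/-! ### Covariances of the estimation error and the despread pilot columns -/

namespace CellFreeSystem

variable {L K τ M : ℕ} {Ω : Type*} (S : CellFreeSystem L K τ) (h : Fin L → Fin K → Ω → (Fin M → ℂ))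
  (N : Fin L → Ω → Matrix (Fin M) (Fin τ) ℂ)

/-- The variance of the entries of column `i` of `Hbar`. -/
def hbarVar (l : Fin L) (i : Fin τ) : ℝ :=
  τ * (τ * ∑ t with S.pilot t = i, S.p t * S.β l t + 1)

/-- The coefficients of column `i` of `Hbar` with respect to the channels and the noise columns. -/
noncomputable def hbarCoef (i : Fin τ) : Fin K ⊕ Fin τ → ℂ :=
  Sum.elim (fun t => if S.pilot t = i then (Real.sqrt (S.p t) : ℂ) * τ else 0) fun s => S.Φ s i

/-- The variances of the entries of the channels and the noise columns. -/
def sourceVar (l : Fin L) : Fin K ⊕ Fin τ → ℝ := Sum.elim (S.β l) fun _ => 1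

/-- The entries of the channels and the noise columns. -/
def source (l : Fin L) (m : Fin M) (q : Fin K ⊕ Fin τ) (ω : Ω) : ℂ :=
  Sum.elim (fun t => h l t ω m) (fun s => N l ω m s) q

/-- The channel estimation error of user `k`, followed by the columns of `Hbar`. -/
noncomputable def errorCols (k : Fin K) (l : Fin L) (ω : Ω) : Fin (τ + 1) → Fin M → ℂ :=
  Fin.cons (fun m => h l k ω m - S.estimate h N l k ω m) fun i m => S.Hbar h N l ω m i

/-- The coefficients of `errorCols` with respect to the channels and the noise columns. -/
noncomputable def errorColsCoef (k : Fin K) (l : Fin L) : Fin (τ + 1) → Fin K ⊕ Fin τ → ℂ :=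
  Fin.cons (fun q => (if q = Sum.inl k then 1 else 0) - S.c l k * S.hbarCoef (S.pilot k) q) S.hbarCoef

/-- The variances of the entries of `errorCols`. -/
noncomputable def errorColsVar (k : Fin K) (l : Fin L) : Fin (τ + 1) → ℝ :=
  Fin.cons (S.β l k - S.γ l k) (S.hbarVar l)

theorem sum_star_Φ_mul_Φ (i j : Fin τ) :
    ∑ s, star (S.Φ s i) * S.Φ s j = if i = j then (τ : ℂ) else 0 := by
  have h1 := congrFun (congrFun S.Φ_orthogonal i) j
  rw [Matrix.mul_apply, Matrix.smul_apply, Matrix.one_apply] at h1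
  simpa using h1

theorem sum_pilot_mul_nonneg (l : Fin L) (i : Fin τ) :
    0 ≤ ∑ t with S.pilot t = i, S.p t * S.β l t :=
  Finset.sum_nonneg fun t _ => mul_nonneg (S.p_nonneg t) (S.β_nonneg l t)

theorem hbarVar_pos (l : Fin L) (i : Fin τ) : 0 < S.hbarVar l i := by
  have h1 := S.sum_pilot_mul_nonneg l i
  have h2 : (0 : ℝ) < τ := by exact_mod_cast i.pos
  unfold hbarVar
  positivity

theorem sourceVar_nonneg (l : Fin L) (q : Fin K ⊕ Fin τ) : 0 ≤ S.sourceVar l q := by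
  rcases q with t | s
  · exact S.β_nonneg l t
  · exact zero_le_one

/-- The MMSE normal equation: the right side is the covariance between an entry of `h_k` and the
same entry of its pilot column. -/
theorem c_mul_hbarVar (l : Fin L) (k : Fin K) :
    S.c l k * S.hbarVar l (S.pilot k) = Real.sqrt (S.p k) * τ * S.β l k := by
  have h1 := S.sum_pilot_mul_nonneg l (S.pilot k)
  have h2 : 0 < (τ : ℝ) * ∑ t with S.pilot t = S.pilot k, S.p t * S.β l t + 1 := by positivity
  rw [c, hbarVar, copilot]
  field_simp

theorem γ_eq (l : Fin L) (k : Fin K) :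
    S.γ l k = S.c l k * (Real.sqrt (S.p k) * τ * S.β l k) := by
  have h1 := S.sum_pilot_mul_nonneg l (S.pilot k)
  have h2 : 0 < (τ : ℝ) * ∑ t with S.pilot t = S.pilot k, S.p t * S.β l t + 1 := by positivity
  have h3 := Real.sq_sqrt (S.p_nonneg k)
  rw [c, γ, copilot]
  conv_lhs => rw [← h3]
  field_simp

theorem γ_eq_sq (l : Fin L) (k : Fin K) :
    S.γ l k = S.c l k ^ 2 * S.hbarVar l (S.pilot k) := by
  rw [γ_eq, ← c_mul_hbarVar]
  ring

theorem c_nonneg (l : Fin L) (k : Fin K) : 0 ≤ S.c l k := by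
  have h1 := S.sum_pilot_mul_nonneg l (S.pilot k)
  have h2 := S.β_nonneg l k
  rw [c, copilot]
  positivity

/-- The denominator of `γ` contains the user's own term `τ p β`. The inequality lets `β - γ` serve
as a variance. -/
theorem γ_le_β (l : Fin L) (k : Fin K) : S.γ l k ≤ S.β l k := by
  have hnn : ∀ t, 0 ≤ S.p t * S.β l t := fun t => mul_nonneg (S.p_nonneg t) (S.β_nonneg l t)
  have h1 : S.p k * S.β l k ≤ ∑ t ∈ S.copilot k, S.p t * S.β l t :=
    Finset.single_le_sum (f := fun t => S.p t * S.β l t) (fun t _ => hnn t) (by simp [copilot])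
  have hτ : (0 : ℝ) ≤ τ := by positivity
  have h2 : 0 < (τ : ℝ) * ∑ t ∈ S.copilot k, S.p t * S.β l t + 1 := by
    have := (hnn k).trans h1
    positivity
  rw [γ, div_le_iff₀ h2]
  have h3 := S.β_nonneg l k
  nlinarith [mul_le_mul_of_nonneg_left h1 (mul_nonneg hτ h3)]

theorem errorColsVar_nonneg (k : Fin K) (l : Fin L) (o : Fin (τ + 1)) :
    0 ≤ S.errorColsVar k l o := by
  refine Fin.cases ?_ (fun i => ?_) o
  · exact sub_nonneg.2 (S.γ_le_β l k)
  · exact (S.hbarVar_pos l i).le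

/-- Distinct columns share no user, since each user has a single pilot, and their noise parts are
uncorrelated because the pilots are orthogonal. -/
theorem sum_hbarCoef_mul_star_hbarCoef (l : Fin L) (i j : Fin τ) :
    ∑ q, S.hbarCoef i q * star (S.hbarCoef j q) * S.sourceVar l q =
      if i = j then (S.hbarVar l i : ℂ) else 0 := by
  have hΦ : ∑ s, S.Φ s i * star (S.Φ s j) = if i = j then (τ : ℂ) else 0 := by
    simp_rw [mul_comm (S.Φ _ i), S.sum_star_Φ_mul_Φ, eq_comm]
  simp only [Fintype.sum_sum_type, hbarCoef, sourceVar, Sum.elim_inl, Sum.elim_inr,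
    Complex.ofReal_one, mul_one, hΦ]
  split_ifs with hij
  · subst hij
    rw [hbarVar, Finset.sum_filter]
    push_cast
    rw [mul_add, mul_one, Finset.mul_sum, Finset.mul_sum]
    congr 1
    refine Finset.sum_congr rfl fun t _ => ?_
    split_ifs
    · have h3 : (Real.sqrt (S.p t) : ℂ) ^ 2 = S.p t := by
        rw [← Complex.ofReal_pow, Real.sq_sqrt (S.p_nonneg t)]
      simp only [star_mul', RCLike.star_def, Complex.conj_ofReal, Complex.conj_natCast]
      push_cast
      linear_combination (τ : ℂ) ^ 2 * S.β l t * h3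
    · simp
  · rw [add_zero]
    refine Finset.sum_eq_zero fun t _ => ?_
    split_ifs with h1 h2
    · exact absurd (h1.symm.trans h2) hij
    all_goals simp

/-- Only the user's own pilot column correlates with `h_k`, and the choice of `c` cancels that
correlation in the error. -/
theorem sum_errorColsCoef_mul_star (k : Fin K) (l : Fin L) (o o' : Fin (τ + 1)) :
    ∑ q, S.errorColsCoef k l o q * star (S.errorColsCoef k l o' q) * S.sourceVar l q =
      if o = o' then (S.errorColsVar k l o : ℂ) else 0 := by
  have hB := S.sum_hbarCoef_mul_star_hbarCoef l
  have hc : ((S.c l k * S.hbarVar l (S.pilot k) : ℝ) : ℂ) =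
      ((Real.sqrt (S.p k) * τ * S.β l k : ℝ) : ℂ) := by rw [c_mul_hbarVar]
  have hγ : (S.γ l k : ℂ) = ((S.c l k * (Real.sqrt (S.p k) * τ * S.β l k) : ℝ) : ℂ) := by
    rw [γ_eq]
  push_cast at hc hγ
  have hk : ∀ i, S.hbarCoef i (Sum.inl k) =
      if S.pilot k = i then (Real.sqrt (S.p k) : ℂ) * τ else 0 := fun i => rfl
  have hv : S.sourceVar l (Sum.inl k) = S.β l k := rfl
  have hstar : ∀ i, star (S.hbarCoef i (Sum.inl k)) = S.hbarCoef i (Sum.inl k) := by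
    intro i
    rw [hk]
    split_ifs <;> simp
  have h0s : ∀ i, ∑ q, S.errorColsCoef k l 0 q * star (S.hbarCoef i q) * S.sourceVar l q = 0 := by
    intro i
    simp only [errorColsCoef, Fin.cons_zero, sub_mul, Finset.sum_sub_distrib, mul_assoc,
      ← Finset.mul_sum]
    simp only [← mul_assoc, hB, ite_mul, one_mul, zero_mul, Finset.sum_ite_eq',
      Finset.mem_univ, if_true, hstar, hv]
    rw [hk]
    split_ifs with hi
    · linear_combination -hc
    · ring
  refine Fin.cases ?_ (fun i => ?_) o <;> refine Fin.cases ?_ (fun i' => ?_) o'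
  · rw [if_pos rfl]
    -- The error is uncorrelated with the estimate, so its variance equals its covariance with
    -- `h_k`, namely `β - c √p τ β = β - γ`.
    have hsplit : ∀ q, S.errorColsCoef k l 0 q * star (S.errorColsCoef k l 0 q) * S.sourceVar l q =
        S.errorColsCoef k l 0 q * star (if q = Sum.inl k then 1 else 0 : ℂ) * S.sourceVar l q -
        S.c l k * (S.errorColsCoef k l 0 q * star (S.hbarCoef (S.pilot k) q) *
          S.sourceVar l q) := by
      intro q
      have : star (S.errorColsCoef k l 0 q) = star (if q = Sum.inl k then 1 else 0 : ℂ) -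
          S.c l k * star (S.hbarCoef (S.pilot k) q) := by
        simp [errorColsCoef]
      rw [this]
      ring
    simp_rw [hsplit]
    rw [Finset.sum_sub_distrib, ← Finset.mul_sum, h0s, mul_zero, sub_zero]
    rw [Finset.sum_eq_single (Sum.inl k) (fun q _ hq => by simp [hq]) (by simp)]
    simp only [errorColsCoef, errorColsVar, Fin.cons_zero, if_true, hk, hv]
    push_cast
    rw [hγ, star_one]
    ring
  · rw [if_neg (Fin.succ_ne_zero i').symm]
    exact h0s i'
  · rw [if_neg (Fin.succ_ne_zero i)]
    have h1 := congrArg star (h0s i)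
    rw [star_sum, star_zero] at h1
    rw [← h1]
    refine Finset.sum_congr rfl fun q _ => ?_
    simp only [star_mul', RCLike.star_def, Complex.conj_ofReal, Complex.conj_conj]
    rw [mul_comm (S.errorColsCoef k l _ q)]
    rfl
  · simp only [Fin.succ_inj]
    exact hB i i'

theorem Hbar_apply (l : Fin L) (ω : Ω) (m : Fin M) (i : Fin τ) :
    S.Hbar h N l ω m i = ∑ q, S.hbarCoef i q * source h N l m q ω := by
  rw [Hbar, Matrix.mul_apply]
  simp only [Fintype.sum_sum_type, hbarCoef, source, Sum.elim_inl, Sum.elim_inr, received,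
    Matrix.add_apply, Matrix.sum_apply, Matrix.smul_apply, Matrix.vecMulVec_apply, pilotSeq,
    Pi.star_apply, add_mul, Finset.sum_add_distrib, Finset.sum_mul]
  congr 1
  · rw [Finset.sum_comm]
    refine Finset.sum_congr rfl fun t _ => ?_
    have h1 := S.sum_star_Φ_mul_Φ (S.pilot t) i
    calc ∑ s, ((Real.sqrt (S.p t) : ℝ) : ℂ) • (h l t ω m * star (S.Φ s (S.pilot t))) * S.Φ s i
        = Real.sqrt (S.p t) * h l t ω m * ∑ s, star (S.Φ s (S.pilot t)) * S.Φ s i := by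
          rw [Finset.mul_sum]
          refine Finset.sum_congr rfl fun s _ => ?_
          rw [smul_eq_mul]
          ring
      _ = _ := by
          rw [h1]
          split_ifs <;> ring
  · exact Finset.sum_congr rfl fun s _ => mul_comm _ _

theorem estimate_apply (l : Fin L) (k : Fin K) (ω : Ω) (m : Fin M) :
    S.estimate h N l k ω m = S.c l k * S.Hbar h N l ω m (S.pilot k) := rfl

theorem errorCols_apply (k : Fin K) (l : Fin L) (ω : Ω) (o : Fin (τ + 1)) (m : Fin M) :
    S.errorCols h N k l ω o m = ∑ q, S.errorColsCoef k l o q * source h N l m q ω := by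
  refine Fin.cases ?_ (fun i => ?_) o
  · simp only [errorCols, errorColsCoef, Fin.cons_zero, estimate_apply, Hbar_apply, sub_mul,
      Finset.sum_sub_distrib, Finset.mul_sum, mul_assoc]
    congr 1
    simp [source]
  · exact S.Hbar_apply h N l ω m i

/-! ### Joint law of errors and pilot columns -/

variable {S h N} [MeasurableSpace Ω] {P : Measure Ω}

theorem IsRayleigh.hasLaw_source (hR : S.IsRayleigh P h N) (l : Fin L) (m : Fin M)
    (q : Fin K ⊕ Fin τ) :
    HasLaw (source h N l m q) (complexGaussian (S.sourceVar l q)) P := by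
  rcases q with t | s
  · exact hR.law_channel l t m
  · exact hR.law_noise l m s

theorem IsRayleigh.iIndepFun_source (hR : S.IsRayleigh P h N) :
    iIndepFun (fun j : (Fin L × Fin M) × (Fin K ⊕ Fin τ) => source h N j.1.1 j.1.2 j.2) P := by
  let e : (Fin L × Fin M) × (Fin K ⊕ Fin τ) → (Fin L × Fin K × Fin M) ⊕ (Fin L × Fin M × Fin τ) :=
    fun j => Sum.elim (fun t => Sum.inl (j.1.1, t, j.1.2)) (fun s => Sum.inr (j.1.1, j.1.2, s)) j.2
  have he : Function.Injective e := by
    rintro ⟨⟨l, m⟩, t | s⟩ ⟨⟨l', m'⟩, t' | s'⟩ hj <;> simp_all [e]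
  convert! hR.indep.precomp he using 1
  ext ⟨⟨l, m⟩, t | s⟩ ω <;> rfl

/-- All entries at all access points are treated as one family of linear forms, with coefficients
block diagonal in `(l, m)`. The joint law thus also yields independence across access points. -/
theorem IsRayleigh.hasLaw_errorCols_pi [IsProbabilityMeasure P] (hR : S.IsRayleigh P h N)
    (k : Fin K) :
    HasLaw (fun ω l => S.errorCols h N k l ω)
      (Measure.pi fun l => Measure.pi fun o => Measure.pi fun _ : Fin M =>
        complexGaussian (S.errorColsVar k l o)) P := by
  have h1 := hasLaw_pi_complexGaussian_of_orthogonal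
    (v := fun j : (Fin L × Fin M) × (Fin K ⊕ Fin τ) => S.sourceVar j.1.1 j.2)
    (fun j => S.sourceVar_nonneg _ _) (fun j => hR.hasLaw_source j.1.1 j.1.2 j.2)
    hR.iIndepFun_source
    (fun (i : (Fin L × Fin (τ + 1)) × Fin M) j =>
      if j.1 = (i.1.1, i.2) then S.errorColsCoef k i.1.1 i.1.2 j.2 else 0)
    (s := fun i => S.errorColsVar k i.1.1 i.1.2) (fun i => S.errorColsVar_nonneg _ _ _) (by
      rintro ⟨⟨l, o⟩, m⟩ ⟨⟨l', o'⟩, m'⟩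
      rw [Fintype.sum_prod_type, Finset.sum_eq_single (l, m)
        (fun x _ hx => by simp [hx]) (by simp)]
      simp only [if_true]
      by_cases hlm : l = l' ∧ m = m'
      · obtain ⟨rfl, rfl⟩ := hlm
        simpa using S.sum_errorColsCoef_mul_star k l o o'
      · have h2 : (l, m) ≠ (l', m') := fun h => hlm (Prod.mk.inj h)
        have h3 : ((l, o), m) ≠ ((l', o'), m') := by
          intro h
          simp only [Prod.mk.injEq] at h
          exact hlm ⟨h.1.1, h.2⟩
        rw [if_neg h3]
        simp [h2])
  have hc1 : MeasurePreserving
      (fun (f : (Fin L × Fin (τ + 1)) × Fin M → ℂ) (i : Fin L × Fin (τ + 1)) (m : Fin M) =>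
        f (i, m)) _ _ :=
    ⟨by fun_prop, pi_map_curry fun (i : Fin L × Fin (τ + 1)) (_ : Fin M) =>
      complexGaussian (S.errorColsVar k i.1 i.2)⟩
  have hc2 : MeasurePreserving
      (fun (f : Fin L × Fin (τ + 1) → Fin M → ℂ) (l : Fin L) (o : Fin (τ + 1)) => f (l, o)) _ _ :=
    ⟨by fun_prop, pi_map_curry fun (l : Fin L) (o : Fin (τ + 1)) => Measure.pi fun _ : Fin M =>
      complexGaussian (S.errorColsVar k l o)⟩
  convert! (hc2.hasLaw.comp (hc1.hasLaw.comp h1)) using 1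
  ext ω l o m
  simp only [Function.comp_apply]
  rw [errorCols_apply, Fintype.sum_prod_type, Finset.sum_eq_single (l, m)
    (fun x _ hx => by simp [hx]) (by simp)]
  simp

theorem IsRayleigh.hasLaw_errorCols [IsProbabilityMeasure P] (hR : S.IsRayleigh P h N)
    (k : Fin K) (l : Fin L) :
    HasLaw (S.errorCols h N k l)
      (Measure.pi fun o => Measure.pi fun _ : Fin M =>
        complexGaussian (S.errorColsVar k l o)) P :=
  (measurePreserving_eval (fun l => Measure.pi fun o => Measure.pi fun _ : Fin M =>
    complexGaussian (S.errorColsVar k l o)) l).hasLaw.comp (hR.hasLaw_errorCols_pi k)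

theorem IsRayleigh.iIndepFun_errorCols [IsProbabilityMeasure P] (hR : S.IsRayleigh P h N)
    (k : Fin K) : iIndepFun (S.errorCols h N k) P :=
  (iIndepFun_iff_hasLaw_pi_pi (hR.hasLaw_errorCols k)).2 (hR.hasLaw_errorCols_pi k)

theorem IsRayleigh.hasLaw_Hbar_cols [IsProbabilityMeasure P] (hR : S.IsRayleigh P h N)
    (k : Fin K) (l : Fin L) :
    HasLaw (fun ω i m => S.Hbar h N l ω m i)
      (Measure.pi fun i => Measure.pi fun _ : Fin M => complexGaussian (S.hbarVar l i)) P :=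
  (measurePreserving_tail (v := S.errorColsVar k l)).hasLaw.comp (hR.hasLaw_errorCols k l)

end CellFreeSystem

/-! ### Effective gains and the SINR -/

namespace CellFreeSystem

variable {L K τ M : ℕ} {Ω : Type*} {S : CellFreeSystem L K τ}
  {h : Fin L → Fin K → Ω → (Fin M → ℂ)} {N : Fin L → Ω → Matrix (Fin M) (Fin τ) ℂ}
  [MeasurableSpace Ω] {P : Measure Ω} [IsProbabilityMeasure P]

theorem IsRayleigh.estimate_moment (hR : S.IsRayleigh P h N) (k : Fin K) (l : Fin L) (m : Fin M) :
    Integrable (fun ω => ‖S.estimate h N l k ω m‖ ^ 2) P ∧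
      ∫ ω, ‖S.estimate h N l k ω m‖ ^ 2 ∂P = S.γ l k := by
  have h1 := hR.hasLaw_Hbar_cols k l
  have h2 := (measurePreserving_eval (fun i : Fin τ => Measure.pi fun _ : Fin M =>
    complexGaussian (S.hbarVar l i)) (S.pilot k)).hasLaw.comp h1
  have h3 : HasLaw (fun ω => S.Hbar h N l ω m (S.pilot k))
      (complexGaussian (S.hbarVar l (S.pilot k))) P :=
    (measurePreserving_eval (fun _ : Fin M =>
      complexGaussian (S.hbarVar l (S.pilot k))) m).hasLaw.comp h2
  have hσ := (S.hbarVar_pos l (S.pilot k)).le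
  have hL : MemLp (fun ω => S.Hbar h N l ω m (S.pilot k)) 2 P := by
    have h4 := memLp_id_complexGaussian (S.hbarVar l (S.pilot k))
    rw [← h3.map_eq, memLp_map_measure_iff (by fun_prop) h3.aemeasurable] at h4
    exact h4
  have h5 : ∫ ω, ‖S.Hbar h N l ω m (S.pilot k)‖ ^ 2 ∂P = S.hbarVar l (S.pilot k) :=
    (h3.integral_comp (f := fun w : ℂ => ‖w‖ ^ 2) (by fun_prop)).trans
      (integral_normSq_complexGaussian hσ)
  have h6 : ∀ ω, ‖S.estimate h N l k ω m‖ ^ 2 =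
      S.c l k ^ 2 * ‖S.Hbar h N l ω m (S.pilot k)‖ ^ 2 := by
    intro ω
    rw [estimate_apply, norm_mul, mul_pow, Complex.norm_real, Real.norm_eq_abs, sq_abs]
  simp_rw [h6]
  refine ⟨hL.norm.integrable_sq.const_mul _, ?_⟩
  rw [integral_const_mul, h5, γ_eq_sq]

theorem IsRayleigh.ae_isUnit_det (hR : S.IsRayleigh P h N) (hM : τ < M) (k : Fin K) (l : Fin L) :
    ∀ᵐ ω ∂P, IsUnit ((S.Hbar h N l ω)ᴴ * S.Hbar h N l ω).det := by
  have h1 := hR.hasLaw_Hbar_cols k l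
  have h2 := ae_linearIndependent_complexGaussian hM (S.hbarVar_pos l)
  rw [← h1.map_eq] at h2
  filter_upwards [ae_of_ae_map h1.aemeasurable h2] with ω hω
  exact isUnit_det_gram hω

/-- The mean square norm of the zero-forcing direction for pilot `i`. -/
noncomputable def zfPower (S : CellFreeSystem L K τ) (M : ℕ) (l : Fin L) (i : Fin τ) : ℝ :=
  (S.hbarVar l i * (M - τ))⁻¹

theorem zfPower_pos (hM : τ < M) (l : Fin L) (i : Fin τ) : 0 < S.zfPower M l i := by
  have h1 : (0 : ℝ) < M - τ := sub_pos.2 (by exact_mod_cast hM)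
  have h2 := S.hbarVar_pos l i
  unfold zfPower
  positivity

theorem IsRayleigh.integrable_vecNormSq_zfDirection (hR : S.IsRayleigh P h N) (hM : τ < M)
    (k : Fin K) (l : Fin L) (i : Fin τ) :
    Integrable (fun ω => vecNormSq (S.zfDirection h N l i ω)) P := by
  have h1 := hR.hasLaw_Hbar_cols k l
  have h2 := integrable_vecNormSq_zfVector hM (S.hbarVar_pos l) i
  rw [← h1.map_eq] at h2
  exact (integrable_map_measure h2.aestronglyMeasurable h1.aemeasurable).1 h2

theorem IsRayleigh.integral_vecNormSq_zfDirection (hR : S.IsRayleigh P h N) (hM : τ < M)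
    (k : Fin K) (l : Fin L) (i : Fin τ) :
    ∫ ω, vecNormSq (S.zfDirection h N l i ω) ∂P = S.zfPower M l i :=
  ((hR.hasLaw_Hbar_cols k l).integral_comp
    (measurable_vecNormSq.comp (measurable_zfVector i)).aestronglyMeasurable).trans
    (integral_vecNormSq_zfVector hM (S.hbarVar_pos l) i)

/-- The mean of the effective scalar channel. -/
noncomputable def meanGain (S : CellFreeSystem L K τ) (M : ℕ) (l : Fin L) (k t : Fin K) : ℝ :=
  if S.pilot k = S.pilot t then Real.sqrt ((M - τ) * S.γ l k) else 0

/-- The fluctuation of the effective scalar channel. -/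
noncomputable def gainFluctuation (S : CellFreeSystem L K τ) (h : Fin L → Fin K → Ω → (Fin M → ℂ))
    (N : Fin L → Ω → Matrix (Fin M) (Fin τ) ℂ) (l : Fin L) (k t : Fin K) (ω : Ω) : ℂ :=
  ((Real.sqrt (S.zfPower M l (S.pilot t)))⁻¹ : ℝ) *
    crossGain (S.pilot t) (S.errorCols h N k l ω)

theorem inv_sqrt_zfPower_mul_c (hM : τ < M) (l : Fin L) (k : Fin K) :
    (Real.sqrt (S.zfPower M l (S.pilot k)))⁻¹ * S.c l k = Real.sqrt ((M - τ) * S.γ l k) := by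
  have h1 : (0 : ℝ) < M - τ := sub_pos.2 (by exact_mod_cast hM)
  have h2 := S.hbarVar_pos l (S.pilot k)
  have h3 := S.c_nonneg l k
  rw [zfPower, γ_eq_sq, Real.sqrt_inv, inv_inv,
    show (M - τ : ℝ) * (S.c l k ^ 2 * S.hbarVar l (S.pilot k)) =
      (S.hbarVar l (S.pilot k) * (M - τ)) * S.c l k ^ 2 by ring,
    Real.sqrt_mul (by positivity) (S.c l k ^ 2), Real.sqrt_sq h3]

/-- Split the channel into estimate plus error. Wherever the Gram matrix is invertible, zero forcing
makes the estimate's contribution deterministic. -/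
theorem IsRayleigh.gain_ae_eq (hR : S.IsRayleigh P h N) (hM : τ < M) (l : Fin L) (k t : Fin K) :
    S.gain h (S.fzf P h N) l k t =ᵐ[P]
      fun ω => (S.meanGain M l k t : ℂ) + S.gainFluctuation h N l k t ω := by
  filter_upwards [hR.ae_isUnit_det hM k l] with ω hω
  have h1 := star_dotProduct_zfVector (g := fun i m => S.Hbar h N l ω m i) hω (S.pilot k)
    (S.pilot t)
  have h2 : star (h l k ω) = (S.c l k : ℂ) • star (fun m => S.Hbar h N l ω m (S.pilot k)) +
      star (S.errorCols h N k l ω 0) := by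
    ext m
    simp [errorCols, estimate_apply]
  have h3 : star (S.errorCols h N k l ω 0) ⬝ᵥ S.zfDirection h N l (S.pilot t) ω =
      crossGain (S.pilot t) (S.errorCols h N k l ω) := rfl
  have h4 : star (fun m => S.Hbar h N l ω m (S.pilot k)) ⬝ᵥ S.zfDirection h N l (S.pilot t) ω =
      if S.pilot k = S.pilot t then 1 else 0 := h1
  rw [gain, fzf, hR.integral_vecNormSq_zfDirection hM k, dotProduct_smul, h2, add_dotProduct,
    smul_dotProduct, h3, h4, gainFluctuation, meanGain, smul_eq_mul, smul_eq_mul, mul_add]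
  push_cast
  congr 1
  split_ifs with hkt
  · rw [← inv_sqrt_zfPower_mul_c hM, hkt]
    push_cast
    ring
  · simp

/-- The precoder normalization cancels the mean power of the zero-forcing direction, so the variance
does not depend on `t`. -/
theorem IsRayleigh.moments_gainFluctuation (hR : S.IsRayleigh P h N) (hM : τ < M)
    (l : Fin L) (k t : Fin K) :
    MemLp (S.gainFluctuation h N l k t) 2 P ∧
    ∫ ω, S.gainFluctuation h N l k t ω ∂P = 0 ∧
    ∫ ω, ‖S.gainFluctuation h N l k t ω‖ ^ 2 ∂P = S.β l k - S.γ l k := by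
  have hlaw := hR.hasLaw_errorCols k l
  obtain ⟨h1, h2, h3⟩ := moments_crossGain (v := S.errorColsVar k l) hM
    (S.errorColsVar_nonneg k l 0) (fun i => S.hbarVar_pos l i) (S.pilot t)
  have hL : MemLp (fun ω => crossGain (S.pilot t) (S.errorCols h N k l ω)) 2 P := by
    rw [← hlaw.map_eq, memLp_map_measure_iff (measurable_crossGain _).aestronglyMeasurable
      hlaw.aemeasurable] at h1
    exact h1
  have hint : ∫ ω, crossGain (S.pilot t) (S.errorCols h N k l ω) ∂P = 0 :=
    (hlaw.integral_comp (measurable_crossGain _).aestronglyMeasurable).trans h2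
  have hsq : ∫ ω, ‖crossGain (S.pilot t) (S.errorCols h N k l ω)‖ ^ 2 ∂P =
      (S.β l k - S.γ l k) * S.zfPower M l (S.pilot t) :=
    (hlaw.integral_comp (f := fun F => ‖crossGain (S.pilot t) F‖ ^ 2)
      ((measurable_crossGain _).norm.pow_const 2).aestronglyMeasurable).trans h3
  have hη := S.zfPower_pos hM l (S.pilot t)
  refine ⟨hL.const_mul _, ?_, ?_⟩
  · simp only [gainFluctuation]
    rw [integral_const_mul, hint, mul_zero]
  · simp only [gainFluctuation, norm_mul, mul_pow, Complex.norm_real, Real.norm_eq_abs, sq_abs]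
    rw [integral_const_mul, hsq, inv_pow, Real.sq_sqrt hη.le]
    field_simp

theorem IsRayleigh.integrable_gain (hR : S.IsRayleigh P h N) (hM : τ < M) (l : Fin L)
    (k t : Fin K) : Integrable (S.gain h (S.fzf P h N) l k t) P :=
  ((integrable_const _).add ((hR.moments_gainFluctuation hM l k t).1.integrable one_le_two)).congr
    (hR.gain_ae_eq hM l k t).symm

theorem IsRayleigh.integral_gain (hR : S.IsRayleigh P h N) (hM : τ < M) (l : Fin L) (k t : Fin K) :
    ∫ ω, S.gain h (S.fzf P h N) l k t ω ∂P = S.meanGain M l k t := by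
  obtain ⟨h1, h2, -⟩ := hR.moments_gainFluctuation hM l k t
  rw [integral_congr_ae (hR.gain_ae_eq hM l k t), integral_add (integrable_const _)
    (h1.integrable one_le_two), h2]
  simp

theorem IsRayleigh.normSq_const_add_sum_gainFluctuation (hR : S.IsRayleigh P h N) (hM : τ < M)
    (k t : Fin K) (a : ℂ) :
    Integrable (fun ω => ‖a + ∑ l, (Real.sqrt (S.ρ l t) : ℂ) * S.gainFluctuation h N l k t ω‖ ^ 2)
      P ∧
    ∫ ω, ‖a + ∑ l, (Real.sqrt (S.ρ l t) : ℂ) * S.gainFluctuation h N l k t ω‖ ^ 2 ∂P =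
      ‖a‖ ^ 2 + ∑ l, S.ρ l t * (S.β l k - S.γ l k) := by
  have hind : iIndepFun (fun l ω => (Real.sqrt (S.ρ l t) : ℂ) * S.gainFluctuation h N l k t ω) P :=
    (hR.iIndepFun_errorCols k).comp (fun l F => (Real.sqrt (S.ρ l t) : ℂ) *
      (((Real.sqrt (S.zfPower M l (S.pilot t)))⁻¹ : ℝ) * crossGain (S.pilot t) F))
      fun l => ((measurable_crossGain _).const_mul _).const_mul _
  obtain ⟨h1, h2⟩ := normSq_const_add_sum_of_iIndepFun
    (fun l => (hR.moments_gainFluctuation hM l k t).1.const_mul (Real.sqrt (S.ρ l t) : ℂ))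
    (fun l => by rw [integral_const_mul, (hR.moments_gainFluctuation hM l k t).2.1, mul_zero])
    hind a
  refine ⟨h1, h2.trans ?_⟩
  congr 1
  refine Finset.sum_congr rfl fun l _ => ?_
  simp only [norm_mul, mul_pow, Complex.norm_real, Real.norm_eq_abs, sq_abs]
  rw [integral_const_mul, (hR.moments_gainFluctuation hM l k t).2.2, Real.sq_sqrt (S.ρ_nonneg l t)]

theorem IsRayleigh.PU_ae_eq (hR : S.IsRayleigh P h N) (hM : τ < M) (k : Fin K) :
    S.PU P h (S.fzf P h N) k =ᵐ[P]
      fun ω => 0 + ∑ l, (Real.sqrt (S.ρ l k) : ℂ) * S.gainFluctuation h N l k k ω := by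
  filter_upwards [ae_all_iff.2 fun l => hR.gain_ae_eq hM l k k] with ω hω
  rw [PU, zero_add]
  refine Finset.sum_congr rfl fun l _ => ?_
  rw [hω, hR.integral_gain hM]
  ring

theorem IsRayleigh.UI_ae_eq (hR : S.IsRayleigh P h N) (hM : τ < M) (k t : Fin K) :
    S.UI h (S.fzf P h N) k t =ᵐ[P]
      fun ω => ((∑ l, Real.sqrt (S.ρ l t) * S.meanGain M l k t : ℝ) : ℂ) +
        ∑ l, (Real.sqrt (S.ρ l t) : ℂ) * S.gainFluctuation h N l k t ω := by
  filter_upwards [ae_all_iff.2 fun l => hR.gain_ae_eq hM l k t] with ω hω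
  rw [UI]
  push_cast
  rw [← Finset.sum_add_distrib]
  refine Finset.sum_congr rfl fun l _ => ?_
  rw [hω]
  ring

theorem sum_sqrt_mul_meanGain_sq (hM : τ < M) (k t : Fin K) :
    (∑ l, Real.sqrt (S.ρ l t) * S.meanGain M l k t) ^ 2 =
      if S.pilot k = S.pilot t then
        ((M : ℝ) - τ) * (∑ l, Real.sqrt (S.ρ l t * S.γ l k)) ^ 2 else 0 := by
  have h1 : (0 : ℝ) < M - τ := sub_pos.2 (by exact_mod_cast hM)
  unfold meanGain
  split_ifs with hkt
  · rw [← Real.sq_sqrt h1.le, ← mul_pow, Finset.mul_sum]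
    congr 1
    refine Finset.sum_congr rfl fun l _ => ?_
    rw [Real.sq_sqrt h1.le, Real.sqrt_mul h1.le, Real.sqrt_mul (S.ρ_nonneg l t)]
    ring
  · simp

theorem IsRayleigh.PU_moment (hR : S.IsRayleigh P h N) (hM : τ < M) (k : Fin K) :
    Integrable (fun ω => ‖S.PU P h (S.fzf P h N) k ω‖ ^ 2) P ∧
    ∫ ω, ‖S.PU P h (S.fzf P h N) k ω‖ ^ 2 ∂P = ∑ l, S.ρ l k * (S.β l k - S.γ l k) := by
  obtain ⟨h1, h2⟩ := hR.normSq_const_add_sum_gainFluctuation hM k k 0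
  have hae : (fun ω => ‖S.PU P h (S.fzf P h N) k ω‖ ^ 2) =ᵐ[P] _ :=
    (hR.PU_ae_eq hM k).fun_comp fun z => ‖z‖ ^ 2
  refine ⟨h1.congr hae.symm, (integral_congr_ae hae).trans (h2.trans ?_)⟩
  simp

theorem IsRayleigh.UI_moment (hR : S.IsRayleigh P h N) (hM : τ < M) (k t : Fin K) :
    Integrable (fun ω => ‖S.UI h (S.fzf P h N) k t ω‖ ^ 2) P ∧
    ∫ ω, ‖S.UI h (S.fzf P h N) k t ω‖ ^ 2 ∂P =
      (if S.pilot k = S.pilot t then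
        ((M : ℝ) - τ) * (∑ l, Real.sqrt (S.ρ l t * S.γ l k)) ^ 2 else 0) +
      ∑ l, S.ρ l t * (S.β l k - S.γ l k) := by
  obtain ⟨h1, h2⟩ := hR.normSq_const_add_sum_gainFluctuation hM k t
    ((∑ l, Real.sqrt (S.ρ l t) * S.meanGain M l k t : ℝ) : ℂ)
  have hae : (fun ω => ‖S.UI h (S.fzf P h N) k t ω‖ ^ 2) =ᵐ[P] _ :=
    (hR.UI_ae_eq hM k t).fun_comp fun z => ‖z‖ ^ 2
  refine ⟨h1.congr hae.symm, (integral_congr_ae hae).trans (h2.trans ?_)⟩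
  rw [Complex.norm_real, Real.norm_eq_abs, sq_abs, sum_sqrt_mul_meanGain_sq hM]

theorem IsRayleigh.CP_normSq (hR : S.IsRayleigh P h N) (hM : τ < M) (k : Fin K) :
    ‖S.CP P h (S.fzf P h N) k‖ ^ 2 =
      ((M : ℝ) - τ) * (∑ l, Real.sqrt (S.ρ l k * S.γ l k)) ^ 2 := by
  have h1 : S.CP P h (S.fzf P h N) k =
      ((∑ l, Real.sqrt (S.ρ l k) * S.meanGain M l k k : ℝ) : ℂ) := by
    simp only [CP, hR.integral_gain hM]
    push_cast
    rfl
  rw [h1, Complex.norm_real, Real.norm_eq_abs, sq_abs, sum_sqrt_mul_meanGain_sq hM, if_pos rfl]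

theorem IsRayleigh.hardeningSINR_fzf (hR : S.IsRayleigh P h N) (hM : τ < M) (k : Fin K) :
    S.hardeningSINR P h (S.fzf P h N) k =
      (((M : ℝ) - (τ : ℝ)) * (∑ l, Real.sqrt (S.ρ l k * S.γ l k)) ^ 2) /
        (((M : ℝ) - (τ : ℝ)) *
            ∑ t ∈ (S.copilot k).erase k, (∑ l, Real.sqrt (S.ρ l t * S.γ l k)) ^ 2 +
          ∑ l, ∑ t, S.ρ l t * (S.β l k - S.γ l k) + 1) := by
  have hcop : (S.copilot k).erase k = (Finset.univ.erase k).filter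
      fun t => S.pilot k = S.pilot t := by
    ext t
    simp [copilot, eq_comm]
  rw [hardeningSINR, hR.CP_normSq hM, (hR.PU_moment hM k).2]
  simp_rw [(hR.UI_moment hM k _).2]
  congr 2
  -- The variance of `PU` is the missing `t = k` term that completes the interference variances to a
  -- sum over all users.
  rw [Finset.sum_add_distrib, hcop, Finset.mul_sum, Finset.sum_filter, Finset.sum_comm (s := .univ),
    ← Finset.add_sum_erase _ _ (Finset.mem_univ k)]
  ring

end CellFreeSystem

theorem corollary1 {L K τ M : ℕ} {Ω : Type*} [MeasurableSpace Ω] (P : Measure Ω)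
    [IsProbabilityMeasure P] (S : CellFreeSystem L K τ)
    (h : Fin L → Fin K → Ω → (Fin M → ℂ)) (N : Fin L → Ω → Matrix (Fin M) (Fin τ) ℂ)
    (hRayleigh : S.IsRayleigh P h N) (hM : τ < M) (k : Fin K) :
    -- `γ` is the mean square of each entry of the channel estimate
    (∀ l m, Integrable (fun ω => ‖S.estimate h N l k ω m‖ ^ 2) P ∧
      ∫ ω, ‖S.estimate h N l k ω m‖ ^ 2 ∂P = S.γ l k) ∧
    -- the precoders are well defined
    (∀ l, ∀ᵐ ω ∂P, IsUnit ((S.Hbar h N l ω)ᴴ * S.Hbar h N l ω).det) ∧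
    (∀ l i, Integrable (fun ω => vecNormSq (S.zfDirection h N l i ω)) P ∧
      0 < ∫ ω, vecNormSq (S.zfDirection h N l i ω) ∂P) ∧
    -- all expectations in the SINR are finite
    (∀ l, Integrable (S.gain h (S.fzf P h N) l k k) P) ∧
    Integrable (fun ω => ‖S.PU P h (S.fzf P h N) k ω‖ ^ 2) P ∧
    (∀ t, Integrable (fun ω => ‖S.UI h (S.fzf P h N) k t ω‖ ^ 2) P) ∧
    -- the closed form of the SINR, and with it of the spectral efficiency
    S.hardeningSINR P h (S.fzf P h N) k =
      (((M : ℝ) - (τ : ℝ)) * (∑ l, Real.sqrt (S.ρ l k * S.γ l k)) ^ 2) /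
        (((M : ℝ) - (τ : ℝ)) *
            ∑ t ∈ (S.copilot k).erase k, (∑ l, Real.sqrt (S.ρ l t * S.γ l k)) ^ 2 +
          ∑ l, ∑ t, S.ρ l t * (S.β l k - S.γ l k) + 1) ∧
    ∀ (ξ : ℝ) (τc : ℕ), 0 < ξ → ξ < 1 → τ < τc →
      S.hardeningSE P h (S.fzf P h N) ξ τc k =
        ξ * (1 - (τ : ℝ) / (τc : ℝ)) * Real.logb 2 (1 +
          (((M : ℝ) - (τ : ℝ)) * (∑ l, Real.sqrt (S.ρ l k * S.γ l k)) ^ 2) /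
            (((M : ℝ) - (τ : ℝ)) *
                ∑ t ∈ (S.copilot k).erase k, (∑ l, Real.sqrt (S.ρ l t * S.γ l k)) ^ 2 +
              ∑ l, ∑ t, S.ρ l t * (S.β l k - S.γ l k) + 1)) := by
  refine ⟨fun l m => hRayleigh.estimate_moment k l m, fun l => hRayleigh.ae_isUnit_det hM k l,
    fun l i => ⟨hRayleigh.integrable_vecNormSq_zfDirection hM k l i, ?_⟩,
    fun l => hRayleigh.integrable_gain hM l k k, (hRayleigh.PU_moment hM k).1,
    fun t => (hRayleigh.UI_moment hM k t).1, hRayleigh.hardeningSINR_fzf hM k,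
    fun ξ τc _ _ _ => ?_⟩
  · rw [hRayleigh.integral_vecNormSq_zfDirection hM k]
    exact CellFreeSystem.zfPower_pos hM l i
  · rw [CellFreeSystem.hardeningSE, hRayleigh.hardeningSINR_fzf hM k]
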